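/- For $c\in\mathbb R$ let $M^2(c)$ be the two-dimensional space form of curvature $c$: the sphere $\langle p,p\rangle=1/c$ in $\mathbb E^3$ if $c>0$, the Euclidean plane if $c=0$, and the upper sheet of the hyperboloid $\langle p,p\rangle=1/c$ in Minkowski space $\mathbb R^3_1$ if $c<0$. Let $c_1,c_2$ be real numbers, not both $0$, and let $M^2$ be a smooth surface immersed in $M^2(c_1)\times M^2(c_2)$, with product metric $\widetilde g$, Levi-Civita connection $\widetilde\nabla$ and product structure $F(X_1+X_2)=X_1-X_2$. Let $g$ be the induced metric on $M^2$ and $\nabla$ its Levi-Civita connection. For a tangent vector $X$ of $M^2$ let $fX$ be the tangent component of $FX$; for a normal vector $\xi$ (tangent to the product and orthogonal to $M^2$) let $t\xi$ be the normal component of $F\xi$; and let $\widetilde\nabla_X\xi=-S_\xi X+\nabla^\perp_X\xi$ be the decomposition into tangent and normal parts defining the shape operators $S_\xi$ and the normal connection $\nabla^\perp$. Suppose that the eigenvalues $\lambda_1<\lambda_2$ of $f$ are constant on $M^2$ and lie in $(-1,1)$, and let $\theta_1,\theta_2\in[0,\frac{\pi}{2}]$ be determined by $\lambda_i=\cos(2\theta_i)$.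 Then every point of $M^2$ has an open neighbourhood $U$ on which there are smooth orthonormal tangent fields $e_1,e_2$, smooth orthonormal normal fields $\xi_1,\xi_2$ and smooth functions $\mu_1,\mu_2$ such that on $U$, for $i=1,2$ and every tangent vector $X$, $$fe_i=\cos(2\theta_i)\,e_i,\qquad t\xi_i=-\cos(2\theta_i)\,\xi_i,$$ $$S_{\xi_1}e_1=0,\quad S_{\xi_1}e_2=\mu_1e_2,\quad S_{\xi_2}e_1=\mu_2e_1,\quad S_{\xi_2}e_2=0,$$ $$g(\nabla_Xe_1,e_2)=\frac{\cos\theta_1\sin\theta_1\,\mu_1\,g(X,e_2)+\cos\theta_2\sin\theta_2\,\mu_2\,g(X,e_1)}{\cos^2\theta_1-\cos^2\theta_2},$$ $$\widetilde g(\nabla^\perp_X\xi_1,\xi_2)=\frac{\cos\theta_1\sin\theta_1\,\mu_2\,g(X,e_1)+\cos\theta_2\sin\theta_2\,\mu_1\,g(X,e_2)}{\cos^2\theta_1-\cos^2\theta_2}.$$ Moreover, at every point of $M^2$ the Gaussian curvature is $K=c_1\cos^2\theta_1\cos^2\theta_2+c_2\sin^2\theta_1\sin^2\theta_2$, and the normal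 curvature $K^\perp=|\widetilde g(R^\perp(e_1,e_2)\xi_2,\xi_1)|$, where $R^\perp$ is the curvature tensor of $\nabla^\perp$ and $\{e_1,e_2\}$, $\{\xi_1,\xi_2\}$ are arbitrary orthonormal bases of the tangent and the normal plane, is $K^\perp=\left|\frac{c_1+c_2}{4}\right|\sin(2\theta_1)\sin(2\theta_2)$. -/

import Mathlib

open scoped Manifold ContDiff Topology

noncomputable section

namespace ProductSurface

/-! ### The space forms `M²(c)` and the product `M²(c₁) × M²(c₂)` -/

/-- The vector space containing the standard models of the two-dimensional space forms. -/
abbrev V3 : Type := Fin 3 → ℝ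

/-- The vector space containing `M²(c₁) × M²(c₂)`. -/
abbrev V6 : Type := V3 × V3

/-- The flat metric of the space containing `M²(c)`: the Euclidean metric of `ℝ³` if `c ≥ 0`, the
Lorentzian metric `-dp₀² + dp₁² + dp₂²` if `c < 0`. -/
def form (c : ℝ) (v w : V3) : ℝ :=
  (if c < 0 then -1 else 1) * (v 0 * w 0) + v 1 * w 1 + v 2 * w 2

/-- The space form `M²(c)`: the sphere `⟨p, p⟩ = 1 / c` if `c > 0`, the plane `p₀ = 0` if `c = 0`,
the upper sheet `p₀ > 0` of the hyperboloid `⟨p, p⟩ = 1 / c` if `c < 0`. -/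
def spaceForm (c : ℝ) : Set V3 :=
  {p | (c = 0 → p 0 = 0) ∧ (c ≠ 0 → form c p p = 1 / c) ∧ (c < 0 → 0 < p 0)}

/-- The orthogonal projection, with respect to `form c`, of the ambient vector space onto the
tangent plane of `M²(c)` at `p`; this plane is `v₀ = 0` if `c = 0` and `⟨p, v⟩ = 0` otherwise. -/
def tangentProj (c : ℝ) (p v : V3) : V3 :=
  if c = 0 then v - v 0 • Pi.single 0 1 else v - (c * form c p v) • p

/-- The vector `v` is tangent to `M²(c)` at `p`. -/
def IsTangent (c : ℝ) (p v : V3) : Prop :=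
  if c = 0 then v 0 = 0 else form c p v = 0

/-- The product metric `g̃`. -/
def prodMetric (c₁ c₂ : ℝ) (v w : V6) : ℝ := form c₁ v.1 w.1 + form c₂ v.2 w.2

/-- The product structure `F (v₁ + v₂) = v₁ - v₂`. -/
def prodStructure (v : V6) : V6 := (v.1, -v.2)

/-! ### Immersed surfaces -/

section Surface

variable {M : Type*} [TopologicalSpace M] [ChartedSpace (EuclideanSpace ℝ (Fin 2)) M]
  [IsManifold (𝓡 2) ∞ M]

/-- `ψ` is a smooth immersion of the surface `M` in `M²(c₁) × M²(c₂)`. -/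
structure IsImmersedSurface (c₁ c₂ : ℝ) (ψ : M → V6) : Prop where
  smooth : ContMDiff (𝓡 2) 𝓘(ℝ, V6) ∞ ψ
  mem_fst : ∀ p, (ψ p).1 ∈ spaceForm c₁
  mem_snd : ∀ p, (ψ p).2 ∈ spaceForm c₂
  injective : ∀ p, Function.Injective (mvfderiv (𝓡 2) ψ p)

/-- The differential of `ψ` at `p`, which identifies `T_pM` with a plane in `V6`. -/
def push (ψ : M → V6) (p : M) (v : TangentSpace (𝓡 2) p) : V6 := mvfderiv (𝓡 2) ψ p v

/-- The metric `g` on `M` induced by `ψ`. -/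
def indMetric (c₁ c₂ : ℝ) (ψ : M → V6) (p : M) (v w : TangentSpace (𝓡 2) p) : ℝ :=
  prodMetric c₁ c₂ (push ψ p v) (push ψ p w)

/-- `ξ` is a normal vector at `p`: it is tangent to `M²(c₁) × M²(c₂)` and orthogonal to `T_pM`. -/
def IsNormalVector (c₁ c₂ : ℝ) (ψ : M → V6) (p : M) (ξ : V6) : Prop :=
  IsTangent c₁ (ψ p).1 ξ.1 ∧ IsTangent c₂ (ψ p).2 ξ.2 ∧
    ∀ v : TangentSpace (𝓡 2) p, prodMetric c₁ c₂ ξ (push ψ p v) = 0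

/-- The component in `T_pM` of `w`: the vector `v` for which `w - dψ v` is orthogonal
to `dψ (T_pM)`. -/
def tanPart (c₁ c₂ : ℝ) (ψ : M → V6) (p : M) (w : V6) : TangentSpace (𝓡 2) p :=
  Classical.epsilon fun v =>
    ∀ z : TangentSpace (𝓡 2) p, prodMetric c₁ c₂ (w - push ψ p v) (push ψ p z) = 0

/-- The component normal to `M` of a vector `w` tangent to `M²(c₁) × M²(c₂)` at `ψ p`. -/
def norPart (c₁ c₂ : ℝ) (ψ : M → V6) (p : M) (w : V6) : V6 :=
  w - push ψ p (tanPart c₁ c₂ ψ p w)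

/-- `f X`, the tangent component of `F X`. -/
def fTensor (c₁ c₂ : ℝ) (ψ : M → V6) (p : M) (v : TangentSpace (𝓡 2) p) : TangentSpace (𝓡 2) p :=
  tanPart c₁ c₂ ψ p (prodStructure (push ψ p v))

/-- `t ξ`, the normal component of `F ξ`. -/
def tTensor (c₁ c₂ : ℝ) (ψ : M → V6) (p : M) (ξ : V6) : V6 :=
  norPart c₁ c₂ ψ p (prodStructure ξ)

/-- `lam` is an eigenvalue of `f` at `p`. -/
def IsEigenvalueAt (c₁ c₂ : ℝ) (ψ : M → V6) (p : M) (lam : ℝ) : Prop :=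
  ∃ v : TangentSpace (𝓡 2) p, v ≠ 0 ∧ fTensor c₁ c₂ ψ p v = lam • v

/-! ### Connections and curvature -/

/-- The Levi-Civita connection `∇̃` of `M²(c₁) × M²(c₂)` along `ψ`: for a field `ξ` along `ψ` that is
tangent to `M²(c₁) × M²(c₂)`, the derivative `∇̃_v ξ` is the component of the flat
derivative `D_v ξ` tangent to `M²(c₁) × M²(c₂)`. -/
def ambientConn (c₁ c₂ : ℝ) (ψ ξ : M → V6) (p : M) (v : TangentSpace (𝓡 2) p) : V6 :=
  (tangentProj c₁ (ψ p).1 (mvfderiv (𝓡 2) ξ p v).1,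
    tangentProj c₂ (ψ p).2 (mvfderiv (𝓡 2) ξ p v).2)

/-- The shape operator: `S_ξ v` is minus the tangent component of `∇̃_v ξ`. -/
def shape (c₁ c₂ : ℝ) (ψ ξ : M → V6) (p : M) (v : TangentSpace (𝓡 2) p) : TangentSpace (𝓡 2) p :=
  -tanPart c₁ c₂ ψ p (ambientConn c₁ c₂ ψ ξ p v)

/-- The normal connection: `∇^⊥_v ξ` is the normal component of `∇̃_v ξ`. -/
def normalConn (c₁ c₂ : ℝ) (ψ ξ : M → V6) (p : M) (v : TangentSpace (𝓡 2) p) : V6 :=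
  norPart c₁ c₂ ψ p (ambientConn c₁ c₂ ψ ξ p v)

/-- The right-hand side of the Koszul formula for `2 g(∇_X Y, Z)` at `p`. -/
def koszul (c₁ c₂ : ℝ) (ψ : M → V6) (X Y Z : (q : M) → TangentSpace (𝓡 2) q) (p : M) : ℝ :=
  mvfderiv (𝓡 2) (fun q => indMetric c₁ c₂ ψ q (Y q) (Z q)) p (X p)
    + mvfderiv (𝓡 2) (fun q => indMetric c₁ c₂ ψ q (X q) (Z q)) p (Y p)
    - mvfderiv (𝓡 2) (fun q => indMetric c₁ c₂ ψ q (X q) (Y q)) p (Z p)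
    + indMetric c₁ c₂ ψ p (VectorField.mlieBracket (𝓡 2) X Y p) (Z p)
    - indMetric c₁ c₂ ψ p (VectorField.mlieBracket (𝓡 2) X Z p) (Y p)
    - indMetric c₁ c₂ ψ p (VectorField.mlieBracket (𝓡 2) Y Z p) (X p)

/-- The Levi-Civita connection `∇` of the induced metric: `∇_v Y` at `p` is the vector determined by
the Koszul formula, for all `X` with `X p = v` and all `Z`. -/
def leviCivita (c₁ c₂ : ℝ) (ψ : M → V6) (Y : (q : M) → TangentSpace (𝓡 2) q) (p : M)
    (v : TangentSpace (𝓡 2) p) : TangentSpace (𝓡 2) p :=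
  Classical.epsilon fun w =>
    ∀ X Z : (q : M) → TangentSpace (𝓡 2) q,
      MDifferentiableAt (𝓡 2) (𝓡 2).tangent
        (fun q => (⟨q, X q⟩ : TangentBundle (𝓡 2) M)) p →
      MDifferentiableAt (𝓡 2) (𝓡 2).tangent
        (fun q => (⟨q, Z q⟩ : TangentBundle (𝓡 2) M)) p →
      X p = v → 2 * indMetric c₁ c₂ ψ p w (Z p) = koszul c₁ c₂ ψ X Y Z p

/-- The curvature `R(X, Y)Z = ∇_X ∇_Y Z - ∇_Y ∇_X Z - ∇_[X, Y] Z` of `M` at `p`. -/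
def curvature (c₁ c₂ : ℝ) (ψ : M → V6) (X Y Z : (q : M) → TangentSpace (𝓡 2) q) (p : M) :
    TangentSpace (𝓡 2) p :=
  leviCivita c₁ c₂ ψ (fun q => leviCivita c₁ c₂ ψ Z q (Y q)) p (X p)
    - leviCivita c₁ c₂ ψ (fun q => leviCivita c₁ c₂ ψ Z q (X q)) p (Y p)
    - leviCivita c₁ c₂ ψ Z p (VectorField.mlieBracket (𝓡 2) X Y p)

/-- The normal curvature tensor
`R^⊥(X, Y)ξ = ∇^⊥_X ∇^⊥_Y ξ - ∇^⊥_Y ∇^⊥_X ξ - ∇^⊥_[X, Y] ξ` at `p`. -/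
def normalCurvature (c₁ c₂ : ℝ) (ψ : M → V6) (X Y : (q : M) → TangentSpace (𝓡 2) q) (ξ : M → V6)
    (p : M) : V6 :=
  normalConn c₁ c₂ ψ (fun q => normalConn c₁ c₂ ψ ξ q (Y q)) p (X p)
    - normalConn c₁ c₂ ψ (fun q => normalConn c₁ c₂ ψ ξ q (X q)) p (Y p)
    - normalConn c₁ c₂ ψ ξ p (VectorField.mlieBracket (𝓡 2) X Y p)

/-- `X` is a smooth tangent vector field on `U`. -/
def IsTangentField (X : (q : M) → TangentSpace (𝓡 2) q) (U : Set M) : Prop :=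
  ContMDiffOn (𝓡 2) (𝓡 2).tangent ∞ (fun q => (⟨q, X q⟩ : TangentBundle (𝓡 2) M)) U

/-- `ξ` is a smooth normal vector field on `U`. -/
def IsNormalField (c₁ c₂ : ℝ) (ψ ξ : M → V6) (U : Set M) : Prop :=
  ContMDiffOn (𝓡 2) 𝓘(ℝ, V6) ∞ ξ U ∧ ∀ q ∈ U, IsNormalVector c₁ c₂ ψ q (ξ q)

/-- The tangent vectors `e₁, e₂` and the normal vectors `ξ₁, ξ₂` at `p` are orthonormal bases of the
tangent plane and the normal plane. -/
structure IsOrthonormalAt (c₁ c₂ : ℝ) (ψ : M → V6) (p : M) (e₁ e₂ : TangentSpace (𝓡 2) p)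
    (ξ₁ ξ₂ : V6) : Prop where
  normal₁ : IsNormalVector c₁ c₂ ψ p ξ₁
  normal₂ : IsNormalVector c₁ c₂ ψ p ξ₂
  tangent₁₁ : indMetric c₁ c₂ ψ p e₁ e₁ = 1
  tangent₂₂ : indMetric c₁ c₂ ψ p e₂ e₂ = 1
  tangent₁₂ : indMetric c₁ c₂ ψ p e₁ e₂ = 0
  normal₁₁ : prodMetric c₁ c₂ ξ₁ ξ₁ = 1
  normal₂₂ : prodMetric c₁ c₂ ξ₂ ξ₂ = 1
  normal₁₂ : prodMetric c₁ c₂ ξ₁ ξ₂ = 0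

/-- The Gaussian curvature of `M` at `p` is `K`:
`g(R(X, Y)Y, X) = K (g(X, X) g(Y, Y) - g(X, Y)²)` at `p` for all smooth vector fields `X, Y`
near `p`. -/
def IsGaussCurvatureAt (c₁ c₂ : ℝ) (ψ : M → V6) (p : M) (K : ℝ) : Prop :=
  ∀ (U : Set M) (X Y : (q : M) → TangentSpace (𝓡 2) q), IsOpen U → p ∈ U →
    IsTangentField X U → IsTangentField Y U →
    indMetric c₁ c₂ ψ p (curvature c₁ c₂ ψ X Y Y p) (X p) =
      K * (indMetric c₁ c₂ ψ p (X p) (X p) * indMetric c₁ c₂ ψ p (Y p) (Y p)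
        - indMetric c₁ c₂ ψ p (X p) (Y p) ^ 2)

/-- The normal curvature `K^⊥` of `M` at `p` is `K`: `|g̃(R^⊥(e₁, e₂)ξ₂, ξ₁)| = K` at `p` for all
smooth tangent fields `e₁, e₂` and normal fields `ξ₁, ξ₂` near `p` that are orthonormal at `p`. -/
def IsNormalCurvatureAt (c₁ c₂ : ℝ) (ψ : M → V6) (p : M) (K : ℝ) : Prop :=
  ∀ (U : Set M) (e₁ e₂ : (q : M) → TangentSpace (𝓡 2) q) (ξ₁ ξ₂ : M → V6), IsOpen U → p ∈ U →
    IsTangentField e₁ U → IsTangentField e₂ U →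
    IsNormalField c₁ c₂ ψ ξ₁ U → IsNormalField c₁ c₂ ψ ξ₂ U →
    IsOrthonormalAt c₁ c₂ ψ p (e₁ p) (e₂ p) (ξ₁ p) (ξ₂ p) →
    |prodMetric c₁ c₂ (normalCurvature c₁ c₂ ψ e₁ e₂ ξ₂ p) (ξ₁ p)| = K

end Surface

end ProductSurface

end

noncomputable section

/-! ### Derivatives of vector-valued functions along vector fields -/

section VectorFieldDerivative

open Set VectorField

variable {E : Type*} [NormedAddCommGroup E] [NormedSpace ℝ E] {H : Type*} [TopologicalSpace H]
  {I : ModelWithCorners ℝ E H} {M : Type*} [TopologicalSpace M] [ChartedSpace H M]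
  {F : Type*} [NormedAddCommGroup F] [NormedSpace ℝ F]

/-! Write `α` and `β` for the connection forms `⟨D a₁, a₂⟩` and `⟨D b₁, b₂⟩` of the frames below,
where `D` is the flat derivative of the ambient vector space.

The metric and the pairing with `F` are the sum and the difference of the metrics of the two
factors. Hence unit eigenvectors `e₁, e₂` of `f` are orthogonal in each factor separately, and their
components have lengths `cos θᵢ` and `sin θᵢ`. Both are positive because the eigenvalues lie in
`(-1, 1)`, so `eᵢ = cos θᵢ aᵢ + sin θᵢ bᵢ` with smooth orthonormal frames `a₁, a₂` and `b₁, b₂` of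
the factors along `ψ` (`exists_isAdaptedFrameOn`), and `ξᵢ = sin θᵢ aᵢ - cos θᵢ bᵢ` spans the normal
plane.

Since the angles are constant, every first-order quantity is a constant combination of `α` and `β`.
Unit length of `aᵢ` and `bᵢ` gives `⟨D eᵢ, ξᵢ⟩ = 0`; symmetry of the second fundamental form then
gives one linear relation between `α` and `β` on each `eᵢ` (`connForm_symm`). This yields the shape
operators and expresses both connections through `μ₁, μ₂`.

The curvatures need no Gauss or Ricci equation. The tangent and the normal connection are both `D`
projected to a plane field with orthonormal frame `E₁, E₂`, whose curvature is the
antisymmetrization of `⟨D_X E₁, D_Y E₂⟩` (`prodMetric_projConn_curvature`). In a space form `⟨D_v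
a₁, D_w a₂⟩ = c ⟨a₁, dπ v⟩ ⟨a₂, dπ w⟩` (`form_mvfderiv_mvfderiv`), so `α` and `β` drop out and
constants remain.

The intrinsic Levi-Civita connection enters through `leviCivita_eq_tanPart`, which rests on `D_X (dψ
Y) - D_Y (dψ X) = dψ [X, Y]`. -/

theorem Filter.EventuallyEq.mvfderiv_eq {u v : M → F} {p : M} (h : u =ᶠ[𝓝 p] v) :
    mvfderiv I u p = mvfderiv I v p := by
  ext w
  have h1 := h.mfderiv_eq (I := I) (I' := 𝓘(ℝ, F))
  simp only [mvfderiv, h1]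
  rfl

theorem mvfderiv_clm_comp {G : Type*} [NormedAddCommGroup G] [NormedSpace ℝ G] (L : F →L[ℝ] G)
    {u : M → F} {p : M} (hu : MDifferentiableAt I 𝓘(ℝ, F) u p) (v : TangentSpace I p) :
    mvfderiv I (fun q => L (u q)) p v = L (mvfderiv I u p v) := by
  have h := mfderiv_comp (I := I) (I' := 𝓘(ℝ, F)) (I'' := 𝓘(ℝ, G)) p
    (L.mdifferentiableAt (x := u p)) hu
  have h2 : mfderiv 𝓘(ℝ, F) 𝓘(ℝ, G) L (u p) = L := by
    rw [mfderiv_eq_fderiv]; exact L.fderiv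
  rw [h2] at h
  exact congrArg (fun T => T v) h

variable [IsManifold I ∞ M]

/-- The function is the fibre component of the tangent map of `u` composed with the section `X`, so
one derivative is lost. -/
theorem ContMDiffOn.mvfderiv_apply {m n : ℕ∞ω} {u : M → F} {U : Set M} (hU : IsOpen U)
    (hu : ContMDiffOn I 𝓘(ℝ, F) n u U) {X : (q : M) → TangentSpace I q}
    (hX : ContMDiffOn I I.tangent m (fun q => (⟨q, X q⟩ : TangentBundle I M)) U)
    (hmn : m + 1 ≤ n) :
    ContMDiffOn I 𝓘(ℝ, F) m (fun q => mvfderiv I u q (X q)) U := by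
  have : IsManifold I 1 M := inferInstance
  have h1 := hu.contMDiffOn_tangentMapWithin hmn hU.uniqueMDiffOn
  have h2 := h1.comp hX (fun q hq => hq)
  have h3 := (contMDiff_snd_tangentBundle_modelSpace F 𝓘(ℝ, F) (n := m)).comp_contMDiffOn h2
  refine h3.congr fun q hq => ?_
  simp only [Function.comp, tangentMapWithin, mfderivWithin_of_isOpen hU hq]
  rfl

/-- The variant for a field that is differentiable at a single point only, as are the test fields in
the definition of `leviCivita`. -/
theorem ContMDiffOn.mdifferentiableAt_mvfderiv_apply {n : ℕ∞ω} {u : M → F} {U : Set M}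
    (hU : IsOpen U) {p : M} (hp : p ∈ U) (hu : ContMDiffOn I 𝓘(ℝ, F) n u U) (hn : 2 ≤ n)
    {X : (q : M) → TangentSpace I q}
    (hX : MDifferentiableAt I I.tangent (fun q => (⟨q, X q⟩ : TangentBundle I M)) p) :
    MDifferentiableAt I 𝓘(ℝ, F) (fun q => mvfderiv I u q (X q)) p := by
  have : IsManifold I 1 M := inferInstance
  have h1 := hu.contMDiffOn_tangentMapWithin (m := 1) hn hU.uniqueMDiffOn
  have hV : IsOpen (Bundle.TotalSpace.proj ⁻¹' U : Set (TangentBundle I M)) :=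
    hU.preimage (FiberBundle.continuous_proj E (TangentSpace I : M → Type _))
  have h1' := (h1.contMDiffAt (x := ⟨p, X p⟩) (hV.mem_nhds hp)).mdifferentiableAt one_ne_zero
  have h2 := h1'.comp p hX
  have h3 := ((contMDiff_snd_tangentBundle_modelSpace F 𝓘(ℝ, F) (n := 1)).mdifferentiable
    one_ne_zero _).comp p h2
  refine h3.congr_of_eventuallyEq ?_
  filter_upwards [hU.mem_nhds hp] with q hq
  simp only [Function.comp, tangentMapWithin, mfderivWithin_of_isOpen hU hq]
  rfl

/-- The vector field `X` read in the chart at `p`. -/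
def chartField (p : M) (X : (q : M) → TangentSpace I q) : E → E :=
  mpullbackWithin 𝓘(ℝ, E) I (extChartAt I p).symm X (range I)

variable [I.Boundaryless]

/-- Chain rule for `u` composed with the inverse chart, whose differential carries `chartField p X`
back to `X`. Without boundary the range of the model is everything, so derivatives within it are
plain derivatives. -/
theorem mvfderiv_apply_eq_fderiv_chartField {u : M → F} (p : M) {x : E}
    (hx : x ∈ (extChartAt I p).target) (X : (q : M) → TangentSpace I q)
    (hu : MDifferentiableAt I 𝓘(ℝ, F) u ((extChartAt I p).symm x)) :
    mvfderiv I u ((extChartAt I p).symm x) (X ((extChartAt I p).symm x)) =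
      fderiv ℝ (u ∘ (extChartAt I p).symm) x (chartField p X x) := by
  have : IsManifold I 1 M := inferInstance
  have hinv := isInvertible_mfderivWithin_extChartAt_symm (I := I) hx
  have hsymm : MDifferentiableAt 𝓘(ℝ, E) I (extChartAt I p).symm x := by
    have := (contMDiffWithinAt_extChartAt_symm_range (I := I) (n := 1) p hx).mdifferentiableWithinAt
      one_ne_zero
    rwa [I.range_eq_univ, mdifferentiableWithinAt_univ] at this
  have hcomp := mfderiv_comp x hu hsymm
  have hX : mfderiv 𝓘(ℝ, E) I (extChartAt I p).symm x (chartField (E := E) p X x) =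
      X ((extChartAt I p).symm x) := by
    simp only [chartField, mpullbackWithin_apply]
    rw [← mfderivWithin_univ, ← I.range_eq_univ]
    exact hinv.self_apply_inverse _
  rw [← hX]
  have := congrArg (fun T => T (chartField (E := E) p X x)) hcomp
  rw [mfderiv_eq_fderiv] at this
  exact this.symm

theorem MDifferentiableAt.differentiableAt_chartField [CompleteSpace E] {p : M}
    {X : (q : M) → TangentSpace I q}
    (hX : MDifferentiableAt I I.tangent (fun q => (⟨q, X q⟩ : TangentBundle I M)) p) :
    DifferentiableAt ℝ (chartField p X) (extChartAt I p p) := by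
  have : IsManifold I 2 M := inferInstance
  have h := MDifferentiableWithinAt.differentiableWithinAt_mpullbackWithin_vectorField
    (mdifferentiableWithinAt_univ.2 hX)
  rw [preimage_univ, univ_inter] at h
  rw [← differentiableWithinAt_univ, ← I.range_eq_univ]
  exact h

/-- `mlieBracket` is by definition the pullback of the bracket in the chart, so the differential of
the chart undoes it. -/
theorem mvfderiv_mlieBracket_apply {u : M → F} {p : M} (X Y : (q : M) → TangentSpace I q)
    (hu : MDifferentiableAt I 𝓘(ℝ, F) u p) :
    mvfderiv I u p (mlieBracket I X Y p) =
      fderiv ℝ (u ∘ (extChartAt I p).symm) (extChartAt I p p)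
        (lieBracket ℝ (chartField p X) (chartField p Y) (extChartAt I p p)) := by
  have : IsManifold I 1 M := inferInstance
  have hinv := isInvertible_mfderiv_extChartAt (I := I) (mem_extChartAt_source (I := I) p)
  have hφ := (contMDiffAt_extChartAt (I := I) (n := 1) (x := p)).mdifferentiableAt one_ne_zero
  set x := extChartAt I p p with hx
  have hxp : (extChartAt I p).symm x = p := extChartAt_to_inv p
  have hsymm : MDifferentiableAt 𝓘(ℝ, E) I (extChartAt I p).symm x := by
    have := (contMDiffWithinAt_extChartAt_symm_range (I := I) (n := 1) p
      (mem_extChartAt_target p)).mdifferentiableWithinAt one_ne_zero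
    rwa [I.range_eq_univ, mdifferentiableWithinAt_univ] at this
  have hu' : MDifferentiableAt 𝓘(ℝ, E) 𝓘(ℝ, F) (u ∘ (extChartAt I p).symm) x :=
    MDifferentiableAt.comp x (by rwa [hxp]) hsymm
  have hcomp : mfderiv I 𝓘(ℝ, F) ((u ∘ (extChartAt I p).symm) ∘ extChartAt I p) p =
      (mfderiv 𝓘(ℝ, E) 𝓘(ℝ, F) (u ∘ (extChartAt I p).symm) x).comp
        (mfderiv I 𝓘(ℝ, E) (extChartAt I p) p) := mfderiv_comp p hu' hφ
  have heq : (u ∘ (extChartAt I p).symm) ∘ extChartAt I p =ᶠ[𝓝 p] u := by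
    filter_upwards [extChartAt_source_mem_nhds (I := I) p] with q hq
    exact congrArg u ((extChartAt I p).left_inv hq)
  have h1 := heq.mfderiv_eq (I := I) (I' := 𝓘(ℝ, F))
  have h2 : mfderiv I 𝓘(ℝ, E) (extChartAt I p) p (mlieBracket I X Y p) =
      lieBracket ℝ (chartField p X) (chartField p Y) x := by
    have h := mlieBracketWithin_apply (I := I) (V := X) (W := Y) (s := univ) (x₀ := p)
    rw [preimage_univ, univ_inter] at h
    set b : E := lieBracket ℝ (chartField p X) (chartField p Y) x with hb
    have h' : mlieBracket I X Y p = (mfderiv I 𝓘(ℝ, E) (extChartAt I p) p).inverse b := by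
      rw [hb, ← lieBracketWithin_univ, ← I.range_eq_univ]
      exact h
    rw [h']
    exact hinv.self_apply_inverse b
  rw [← h2, ← heq.mvfderiv_eq]
  have := congrArg (fun T => T (mlieBracket I X Y p)) hcomp
  rw [mfderiv_eq_fderiv] at this
  exact this

/-- The commutator of the derivatives along two vector fields is the derivative along their
Lie bracket. -/
theorem ContMDiffOn.mvfderiv_mlieBracket [CompleteSpace E] {n : ℕ∞ω} {u : M → F} {U : Set M}
    (hU : IsOpen U) {p : M} (hp : p ∈ U) (hu : ContMDiffOn I 𝓘(ℝ, F) n u U) (hn : 2 ≤ n)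
    {X Y : (q : M) → TangentSpace I q}
    (hX : MDifferentiableAt I I.tangent (fun q => (⟨q, X q⟩ : TangentBundle I M)) p)
    (hY : MDifferentiableAt I I.tangent (fun q => (⟨q, Y q⟩ : TangentBundle I M)) p) :
    mvfderiv I u p (mlieBracket I X Y p) =
      mvfderiv I (fun q => mvfderiv I u q (Y q)) p (X p) -
        mvfderiv I (fun q => mvfderiv I u q (X q)) p (Y p) := by
  have : IsManifold I 2 M := inferInstance
  set x := extChartAt I p p with hx
  have hxp : (extChartAt I p).symm x = p := extChartAt_to_inv p
  have hxt : x ∈ (extChartAt I p).target := mem_extChartAt_target p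
  have hu2 : ContDiffAt ℝ 2 (u ∘ (extChartAt I p).symm) x := by
    have h1 := (contMDiffWithinAt_extChartAt_symm_range (I := I) (n := 2) p hxt)
    rw [I.range_eq_univ, contMDiffWithinAt_univ] at h1
    have h2 := ((hu.contMDiffAt (hU.mem_nhds hp)).of_le hn)
    rw [← hxp] at h2
    exact (h2.comp x h1).contDiffAt
  have hdiff : ∀ q ∈ U, MDifferentiableAt I 𝓘(ℝ, F) u q := fun q hq =>
    (hu.contMDiffAt (hU.mem_nhds hq)).mdifferentiableAt (by rintro rfl; simp at hn)
  -- In the chart an iterated derivative is the Hessian of `u` plus `du` applied to the derivative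
  -- of the field. The Hessian is symmetric and cancels in the commutator; the rest is `du` of the
  -- bracket.
  have key : ∀ Y Z : (q : M) → TangentSpace I q,
      MDifferentiableAt I I.tangent (fun q => (⟨q, Y q⟩ : TangentBundle I M)) p →
      mvfderiv I (fun q => mvfderiv I u q (Y q)) p (Z p) =
        fderiv ℝ (fderiv ℝ (u ∘ (extChartAt I p).symm)) x (chartField p Z x) (chartField p Y x) +
          fderiv ℝ (u ∘ (extChartAt I p).symm) x
            (fderiv ℝ (chartField p Y) x (chartField p Z x)) := by
    intro Y Z hY
    have h1 := mvfderiv_apply_eq_fderiv_chartField p hxt Z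
      (u := fun q => mvfderiv I u q (Y q))
      (by rw [hxp]; exact hu.mdifferentiableAt_mvfderiv_apply hU hp hn hY)
    rw [hxp] at h1
    rw [h1]
    have h2 : (fun q => mvfderiv I u q (Y q)) ∘ (extChartAt I p).symm =ᶠ[𝓝 x]
        fun y => fderiv ℝ (u ∘ (extChartAt I p).symm) y (chartField p Y y) := by
      have hc := (continuousAt_extChartAt_symm (I := I) p).preimage_mem_nhds
        (by rw [hxp]; exact hU.mem_nhds hp)
      filter_upwards [hc, extChartAt_target_mem_nhds (I := I) p] with y hy hyt
      exact mvfderiv_apply_eq_fderiv_chartField p hyt Y (hdiff _ hy)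
    rw [h2.fderiv_eq, fderiv_clm_apply
      ((hu2.fderiv_right (m := 1) le_rfl).differentiableAt one_ne_zero)
      hY.differentiableAt_chartField]
    simp [add_comm]
  rw [mvfderiv_mlieBracket_apply X Y (hdiff p hp), key Y X hY, key X Y hX, lieBracket, map_sub]
  have hs := (hu2.isSymmSndFDerivAt (by simp)) (chartField p X x) (chartField p Y x)
  rw [← hx, hs]
  abel

end VectorFieldDerivative

namespace ProductSurface

/-! ### The flat forms and the tangent planes of the space forms -/

theorem form_comm (c : ℝ) (v w : V3) : form c v w = form c w v := by
  simp only [form]; ring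

theorem form_add_left (c : ℝ) (u v w : V3) : form c (u + v) w = form c u w + form c v w := by
  simp only [form, Pi.add_apply]; ring

theorem form_smul_left (c r : ℝ) (v w : V3) : form c (r • v) w = r * form c v w := by
  simp only [form, Pi.smul_apply, smul_eq_mul]; ring

theorem form_add_right (c : ℝ) (u v w : V3) : form c u (v + w) = form c u v + form c u w := by
  simp only [form, Pi.add_apply]; ring

theorem form_smul_right (c r : ℝ) (v w : V3) : form c v (r • w) = r * form c v w := by
  simp only [form, Pi.smul_apply, smul_eq_mul]; ring

/-- The form `form c` as a bilinear map. -/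
def formL (c : ℝ) : V3 →L[ℝ] V3 →L[ℝ] ℝ :=
  LinearMap.toContinuousLinearMap (LinearMap.toContinuousLinearMap.toLinearMap ∘ₗ
    LinearMap.mk₂ ℝ (form c) (form_add_left c) (form_smul_left c) (form_add_right c)
      (fun r v w => form_smul_right c r v w))

theorem formL_apply (c : ℝ) (v w : V3) : formL c v w = form c v w := rfl

/-- The product metric as a bilinear map. -/
def prodMetricL (c₁ c₂ : ℝ) : V6 →L[ℝ] V6 →L[ℝ] ℝ :=
  (formL c₁).bilinearComp (.fst ℝ V3 V3) (.fst ℝ V3 V3) +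
    (formL c₂).bilinearComp (.snd ℝ V3 V3) (.snd ℝ V3 V3)

theorem prodMetricL_apply (c₁ c₂ : ℝ) (v w : V6) :
    prodMetricL c₁ c₂ v w = prodMetric c₁ c₂ v w := rfl

theorem prodMetric_comm (c₁ c₂ : ℝ) (v w : V6) : prodMetric c₁ c₂ v w = prodMetric c₁ c₂ w v := by
  simp only [prodMetric, form_comm _ v.1, form_comm _ v.2]

theorem prodMetric_add_left (c₁ c₂ : ℝ) (u v w : V6) :
    prodMetric c₁ c₂ (u + v) w = prodMetric c₁ c₂ u w + prodMetric c₁ c₂ v w := by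
  simp [← prodMetricL_apply]

theorem prodMetric_add_right (c₁ c₂ : ℝ) (u v w : V6) :
    prodMetric c₁ c₂ u (v + w) = prodMetric c₁ c₂ u v + prodMetric c₁ c₂ u w := by
  simp [← prodMetricL_apply]

theorem prodMetric_sub_left (c₁ c₂ : ℝ) (u v w : V6) :
    prodMetric c₁ c₂ (u - v) w = prodMetric c₁ c₂ u w - prodMetric c₁ c₂ v w := by
  simp [← prodMetricL_apply]

theorem prodMetric_smul_left (c₁ c₂ r : ℝ) (v w : V6) :
    prodMetric c₁ c₂ (r • v) w = r * prodMetric c₁ c₂ v w := by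
  simp [← prodMetricL_apply]

theorem prodMetric_smul_right (c₁ c₂ r : ℝ) (v w : V6) :
    prodMetric c₁ c₂ v (r • w) = r * prodMetric c₁ c₂ v w := by
  simp [← prodMetricL_apply]

theorem isTangent_smul {c : ℝ} {p v : V3} (r : ℝ) (hv : IsTangent c p v) :
    IsTangent c p (r • v) := by
  unfold IsTangent at *
  split_ifs at * with h
  · simp [hv]
  · rw [form_smul_right, hv, mul_zero]

/-- Only `c < 0` is not immediate: there `p` is timelike, and by Cauchy-Schwarz its orthogonal
complement is spacelike. -/
theorem form_self_pos {c : ℝ} {p v : V3} (hp : p ∈ spaceForm c) (hv : IsTangent c p v)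
    (hv0 : v ≠ 0) : 0 < form c v v := by
  have hne : v 0 ≠ 0 ∨ v 1 ≠ 0 ∨ v 2 ≠ 0 := by
    by_contra! h
    exact hv0 (by ext i; fin_cases i <;> simp [h])
  rcases lt_or_ge c 0 with hc | hc
  · obtain ⟨-, h1, h2⟩ := hp
    have h1 := h1 hc.ne
    have h2 := h2 hc
    simp only [IsTangent, hc.ne, if_false, form, hc, if_true] at hv h1 ⊢
    have hc' : 1 / c < 0 := one_div_neg.2 hc
    have h3 : p 1 ^ 2 + p 2 ^ 2 < p 0 ^ 2 := by nlinarith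
    -- Orthogonality reads `v₀ p₀ = v₁ p₁ + v₂ p₂`; this is Cauchy-Schwarz for the right-hand side.
    have h4 : (v 0 * p 0) ^ 2 ≤ (v 1 ^ 2 + v 2 ^ 2) * (p 1 ^ 2 + p 2 ^ 2) := by
      have : v 0 * p 0 = v 1 * p 1 + v 2 * p 2 := by linarith
      rw [this]
      nlinarith [sq_nonneg (v 1 * p 2 - v 2 * p 1)]
    by_contra! hle
    have h5 : v 1 ^ 2 + v 2 ^ 2 ≤ v 0 ^ 2 := by nlinarith
    have hv00 : v 0 ≠ 0 := by
      rintro h0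
      rw [h0] at h5
      have a1 : v 1 = 0 := by nlinarith [sq_nonneg (v 1), sq_nonneg (v 2)]
      have a2 : v 2 = 0 := by nlinarith [sq_nonneg (v 1), sq_nonneg (v 2)]
      simp [h0, a1, a2] at hne
    have h6 : 0 < v 0 ^ 2 := by positivity
    nlinarith [sq_nonneg (p 1), sq_nonneg (p 2)]
  · simp only [form, not_lt.2 hc, if_false]
    rcases hne with h | h | h <;> have := mul_self_pos.2 h <;>
      nlinarith [mul_self_nonneg (v 0), mul_self_nonneg (v 1), mul_self_nonneg (v 2)]

/-- A normal vector of `M²(c)` at `p` in the ambient vector space. -/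
def ambientNormal (c : ℝ) (p : V3) : V3 := if c = 0 then Pi.single 0 1 else p

theorem isTangent_iff {c : ℝ} {p v : V3} : IsTangent c p v ↔ form c (ambientNormal c p) v = 0 := by
  unfold IsTangent ambientNormal
  split_ifs with h
  · simp [form, h]
  · rfl

theorem form_ambientNormal_ne_zero {c : ℝ} {p : V3} (hp : p ∈ spaceForm c) :
    form c (ambientNormal c p) (ambientNormal c p) ≠ 0 := by
  unfold ambientNormal
  split_ifs with h
  · simp [form, h]
  · rw [hp.2.1 h]; exact one_div_ne_zero h

/-- One formula for the plane and the curved case: for `c ≠ 0` the normal is `p` with `⟨p, p⟩ = 1 /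
c`, so dividing by it is multiplying by `c`. -/
theorem tangentProj_eq {c : ℝ} {p : V3} (hp : p ∈ spaceForm c) (v : V3) :
    tangentProj c p v = v - (form c (ambientNormal c p) v /
      form c (ambientNormal c p) (ambientNormal c p)) • ambientNormal c p := by
  unfold tangentProj ambientNormal
  split_ifs with h
  · simp [form, h]
  · rw [hp.2.1 h]
    congr 2
    field_simp

theorem isTangent_tangentProj {c : ℝ} {p : V3} (hp : p ∈ spaceForm c) (v : V3) :
    IsTangent c p (tangentProj c p v) := by
  rw [isTangent_iff, tangentProj_eq hp]
  have := form_ambientNormal_ne_zero hp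
  simp only [← formL_apply] at *
  simp only [map_sub, map_smul, smul_eq_mul]
  field_simp
  ring

theorem form_tangentProj {c : ℝ} {p w : V3} (hp : p ∈ spaceForm c) (hw : IsTangent c p w) (v : V3) :
    form c (tangentProj c p v) w = form c v w := by
  rw [isTangent_iff] at hw
  rw [tangentProj_eq hp]
  simp only [← formL_apply] at *
  simp [hw]

/-- The rows of `A` are `n, a₁, a₂`, and `B` is the transpose with the sign of the form absorbed in
its first row. So `A * B` is the Gram matrix, which is diagonal and invertible, and the hypotheses
on `w` say that `A` kills `w` with its first entry multiplied by that sign. -/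
theorem eq_zero_of_form_eq_zero {c : ℝ} {n a₁ a₂ w : V3} (hn : form c n n ≠ 0)
    (h₁ : form c a₁ a₁ = 1) (h₂ : form c a₂ a₂ = 1) (h₁₂ : form c a₁ a₂ = 0)
    (hn₁ : form c n a₁ = 0) (hn₂ : form c n a₂ = 0) (hwn : form c w n = 0) (hw₁ : form c w a₁ = 0)
    (hw₂ : form c w a₂ = 0) : w = 0 := by
  set s : ℝ := if c < 0 then -1 else 1 with hs
  have hs0 : s ≠ 0 := by rw [hs]; split_ifs <;> norm_num
  set A : Matrix (Fin 3) (Fin 3) ℝ := !![n 0, n 1, n 2; a₁ 0, a₁ 1, a₁ 2; a₂ 0, a₂ 1, a₂ 2] with hA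
  set B : Matrix (Fin 3) (Fin 3) ℝ :=
    !![s * n 0, s * a₁ 0, s * a₂ 0; n 1, a₁ 1, a₂ 1; n 2, a₁ 2, a₂ 2] with hB
  have hAB : A * B = Matrix.diagonal ![form c n n, 1, 1] := by
    have e1 := form_comm c a₁ n
    have e2 := form_comm c a₂ n
    have e3 := form_comm c a₂ a₁
    simp only [form, ← hs] at *
    ext i j
    fin_cases i <;> fin_cases j <;>
      simp [hA, hB, Matrix.mul_apply, Fin.sum_univ_three, Matrix.diagonal] <;> linarith
  have hdet : A.det ≠ 0 := by
    intro h0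
    have := congrArg Matrix.det hAB
    rw [Matrix.det_mul, h0, zero_mul, Matrix.det_diagonal] at this
    simp [Fin.prod_univ_three] at this
    exact hn this.symm
  have hw : A.mulVec ![s * w 0, w 1, w 2] = 0 := by
    simp only [form, ← hs] at hwn hw₁ hw₂
    ext i
    fin_cases i <;> simp [hA, Matrix.mulVec, dotProduct, Fin.sum_univ_three] <;> linarith
  have h0 := Matrix.eq_zero_of_mulVec_eq_zero hdet hw
  have e0 := congrFun h0 0
  have e1 := congrFun h0 1
  have e2 := congrFun h0 2
  simp at e0 e1 e2
  ext i
  fin_cases i <;> simp_all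

/-- The expansion of a projected vector in an orthonormal basis of the tangent plane. -/
theorem tangentProj_eq_of_orthonormal {c : ℝ} {p a₁ a₂ : V3} (hp : p ∈ spaceForm c)
    (ht₁ : IsTangent c p a₁) (ht₂ : IsTangent c p a₂)
    (h₁ : form c a₁ a₁ = 1) (h₂ : form c a₂ a₂ = 1) (h₁₂ : form c a₁ a₂ = 0) (w : V3) :
    tangentProj c p w = form c w a₁ • a₁ + form c w a₂ • a₂ := by
  have h := form_tangentProj hp ht₁ w
  have h' := form_tangentProj hp ht₂ w
  have h'' := isTangent_iff.1 (isTangent_tangentProj hp w)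
  rw [isTangent_iff] at ht₁ ht₂
  rw [← sub_eq_zero]
  refine eq_zero_of_form_eq_zero (form_ambientNormal_ne_zero hp) h₁ h₂ h₁₂ ht₁ ht₂ ?_ ?_ ?_
  all_goals
    rw [form_comm] 
    have h21 := form_comm c a₂ a₁
    have c1 := form_comm c a₁ (tangentProj c p w)
    have c2 := form_comm c a₂ (tangentProj c p w)
    simp only [← formL_apply] at *
    simp [*]

theorem tangentProj_of_isTangent {c : ℝ} {p v : V3} (hp : p ∈ spaceForm c)
    (hv : IsTangent c p v) : tangentProj c p v = v := by
  rw [tangentProj_eq hp, isTangent_iff.1 hv]; simp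

end ProductSurface

/-! ### Bilinear expressions in vector-valued functions: smoothness and the product rule. -/

section Bilinear

variable {E : Type*} [NormedAddCommGroup E] [NormedSpace ℝ E] {H : Type*} [TopologicalSpace H]
  {I : ModelWithCorners ℝ E H} {M : Type*} [TopologicalSpace M] [ChartedSpace H M]
  {F G K : Type*} [NormedAddCommGroup F] [NormedSpace ℝ F] [NormedAddCommGroup G] [NormedSpace ℝ G]
  [NormedAddCommGroup K] [NormedSpace ℝ K]

theorem ContMDiffOn.bilinear_apply (B : F →L[ℝ] G →L[ℝ] K) {n : ℕ∞ω} {u : M → F} {v : M → G}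
    {U : Set M} (hu : ContMDiffOn I 𝓘(ℝ, F) n u U) (hv : ContMDiffOn I 𝓘(ℝ, G) n v U) :
    ContMDiffOn I 𝓘(ℝ, K) n (fun q => B (u q) (v q)) U :=
  B.isBoundedBilinearMap.contDiff.contMDiff.comp_contMDiffOn (hu.prodMk_space hv)

theorem MDifferentiableAt.bilinear_apply (B : F →L[ℝ] G →L[ℝ] K) {u : M → F} {v : M → G} {p : M}
    (hu : MDifferentiableAt I 𝓘(ℝ, F) u p) (hv : MDifferentiableAt I 𝓘(ℝ, G) v p) :
    MDifferentiableAt I 𝓘(ℝ, K) (fun q => B (u q) (v q)) p :=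
  MDifferentiableAt.comp (g := fun x : F × G => B x.1 x.2) (f := fun q => (u q, v q)) p
    (B.isBoundedBilinearMap.differentiableAt (u p, v p)).mdifferentiableAt (hu.prodMk_space hv)

theorem mvfderiv_bilinear_apply (B : F →L[ℝ] G →L[ℝ] K) {u : M → F} {v : M → G} {p : M}
    (hu : MDifferentiableAt I 𝓘(ℝ, F) u p) (hv : MDifferentiableAt I 𝓘(ℝ, G) v p)
    (w : TangentSpace I p) :
    mvfderiv I (fun q => B (u q) (v q)) p w =
      B (mvfderiv I u p w) (v p) + B (u p) (mvfderiv I v p w) := by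
  have hx : (extChartAt I p).symm (extChartAt I p p) = p := extChartAt_to_inv p
  have hs : UniqueDiffWithinAt ℝ (Set.range I) (extChartAt I p p) := I.uniqueDiffWithinAt_image
  rw [hu.mvfderiv, hv.mvfderiv, (hu.bilinear_apply B hv).mvfderiv]
  have hu' := hu.differentiableWithinAt_writtenInExtChartAt
  have hv' := hv.differentiableWithinAt_writtenInExtChartAt
  have h := B.fderivWithin_of_bilinear hu' hv' hs
  have h2 : (fun q => B (writtenInExtChartAt I 𝓘(ℝ, F) p u q) (writtenInExtChartAt I 𝓘(ℝ, G) p v q))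
    = writtenInExtChartAt I 𝓘(ℝ, K) p (fun q => B (u q) (v q)) := rfl
  rw [h2] at h
  have h3 := congrArg (fun T => T w) h
  have h4 : writtenInExtChartAt I 𝓘(ℝ, F) p u (extChartAt I p p) = u p := congrArg u hx
  have h5 : writtenInExtChartAt I 𝓘(ℝ, G) p v (extChartAt I p p) = v p := congrArg v hx
  rw [h4, h5] at h3
  refine h3.trans ?_
  exact add_comm _ _

end Bilinear

namespace ProductSurface

/-! ### Tangent fields of a space form along a map -/

section Along

variable {M : Type*} [TopologicalSpace M] [ChartedSpace (EuclideanSpace ℝ (Fin 2)) M]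

theorem mvfderiv_form {c : ℝ} {u v : M → V3} {p : M} (hu : MDifferentiableAt (𝓡 2) 𝓘(ℝ, V3) u p)
    (hv : MDifferentiableAt (𝓡 2) 𝓘(ℝ, V3) v p) (w : TangentSpace (𝓡 2) p) :
    mvfderiv (𝓡 2) (fun q => form c (u q) (v q)) p w =
      form c (mvfderiv (𝓡 2) u p w) (v p) + form c (u p) (mvfderiv (𝓡 2) v p w) :=
  mvfderiv_bilinear_apply (formL c) hu hv w

theorem form_mvfderiv_add_eq_zero {c r : ℝ} {u v : M → V3} {p : M}
    (hu : MDifferentiableAt (𝓡 2) 𝓘(ℝ, V3) u p) (hv : MDifferentiableAt (𝓡 2) 𝓘(ℝ, V3) v p)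
    (h : ∀ᶠ q in 𝓝 p, form c (u q) (v q) = r) (w : TangentSpace (𝓡 2) p) :
    form c (mvfderiv (𝓡 2) u p w) (v p) + form c (u p) (mvfderiv (𝓡 2) v p w) = 0 := by
  rw [← mvfderiv_form hu hv]
  have h1 : (fun q => form c (u q) (v q)) =ᶠ[𝓝 p] fun _ => r := h
  rw [h1.mvfderiv_eq, mvfderiv_const]
  rfl

theorem mvfderiv_apply_zero_eq {u : M → V3} {p : M} (hu : MDifferentiableAt (𝓡 2) 𝓘(ℝ, V3) u p)
    (h : ∀ᶠ q in 𝓝 p, u q 0 = 0) (w : TangentSpace (𝓡 2) p) : mvfderiv (𝓡 2) u p w 0 = 0 := by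
  have h1 := mvfderiv_clm_comp (ContinuousLinearMap.proj (R := ℝ) (φ := fun _ : Fin 3 => ℝ) 0) hu w
  have h2 : (fun q => (ContinuousLinearMap.proj (R := ℝ) (φ := fun _ : Fin 3 => ℝ) 0) (u q))
    =ᶠ[𝓝 p] fun _ => 0 := h
  rw [h2.mvfderiv_eq, mvfderiv_const] at h1
  exact h1.symm

theorem isTangent_mvfderiv {c : ℝ} {π : M → V3} {p : M}
    (hπ : MDifferentiableAt (𝓡 2) 𝓘(ℝ, V3) π p) (h : ∀ᶠ q in 𝓝 p, π q ∈ spaceForm c)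
    (w : TangentSpace (𝓡 2) p) : IsTangent c (π p) (mvfderiv (𝓡 2) π p w) := by
  unfold IsTangent
  split_ifs with hc
  · exact mvfderiv_apply_zero_eq hπ (h.mono fun q hq => hq.1 hc) w
  · have h1 := form_mvfderiv_add_eq_zero hπ hπ (h.mono fun q hq => hq.2.1 hc) w
    rw [form_comm] at h1
    linarith

/-- The derivative of a tangent field along `π`, decomposed into its tangent and normal parts. -/
theorem mvfderiv_eq_tangentProj_sub {c : ℝ} {π a : M → V3} {p : M}
    (hπ : MDifferentiableAt (𝓡 2) 𝓘(ℝ, V3) π p) (ha : MDifferentiableAt (𝓡 2) 𝓘(ℝ, V3) a p)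
    (h : ∀ᶠ q in 𝓝 p, IsTangent c (π q) (a q)) (w : TangentSpace (𝓡 2) p) :
    mvfderiv (𝓡 2) a p w = tangentProj c (π p) (mvfderiv (𝓡 2) a p w) -
      (c * form c (a p) (mvfderiv (𝓡 2) π p w)) • π p := by
  unfold tangentProj IsTangent at *
  split_ifs at * with hc
  · simp [mvfderiv_apply_zero_eq ha h w, hc]
  -- Differentiating `⟨π, a⟩ = 0` replaces `⟨π, D a⟩` by `-⟨a, dπ⟩`.
  · have h1 := form_mvfderiv_add_eq_zero hπ ha h w
    rw [form_comm c (mvfderiv (𝓡 2) π p w)] at h1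
    rw [eq_neg_of_add_eq_zero_left h1]
    simp

/-- For an orthonormal tangent frame `a₁, a₂` of `M²(c)` along `π`, the derivatives of the frame
fields have an inner product determined by the differential of `π`. -/
theorem form_mvfderiv_mvfderiv {c : ℝ} {π a₁ a₂ : M → V3} {p : M} (hp : π p ∈ spaceForm c)
    (hπ : MDifferentiableAt (𝓡 2) 𝓘(ℝ, V3) π p) (ha₁ : MDifferentiableAt (𝓡 2) 𝓘(ℝ, V3) a₁ p)
    (ha₂ : MDifferentiableAt (𝓡 2) 𝓘(ℝ, V3) a₂ p)
    (ht₁ : ∀ᶠ q in 𝓝 p, IsTangent c (π q) (a₁ q)) (ht₂ : ∀ᶠ q in 𝓝 p, IsTangent c (π q) (a₂ q))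
    (h₁ : ∀ᶠ q in 𝓝 p, form c (a₁ q) (a₁ q) = 1) (h₂ : ∀ᶠ q in 𝓝 p, form c (a₂ q) (a₂ q) = 1)
    (h₁₂ : ∀ᶠ q in 𝓝 p, form c (a₁ q) (a₂ q) = 0) (v w : TangentSpace (𝓡 2) p) :
    form c (mvfderiv (𝓡 2) a₁ p v) (mvfderiv (𝓡 2) a₂ p w) =
      c * form c (a₁ p) (mvfderiv (𝓡 2) π p v) * form c (a₂ p) (mvfderiv (𝓡 2) π p w) := by
  have k₁ := form_mvfderiv_add_eq_zero ha₁ ha₁ h₁ v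
  have k₂ := form_mvfderiv_add_eq_zero ha₂ ha₂ h₂ w
  have e₁ := mvfderiv_eq_tangentProj_sub hπ ha₁ ht₁ v
  have e₂ := mvfderiv_eq_tangentProj_sub hπ ha₂ ht₂ w
  have t₁ := ht₁.self_of_nhds
  have t₂ := ht₂.self_of_nhds
  have o₁ := h₁.self_of_nhds
  have o₂ := h₂.self_of_nhds
  have o₁₂ := h₁₂.self_of_nhds
  rw [tangentProj_eq_of_orthonormal hp t₁ t₂ o₁ o₂ o₁₂] at e₁ e₂
  -- Unit length leaves `D a₁` only its `a₂` and `π` components, and `D a₂` only its `a₁` and `π`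
  -- components. The tangent parts are orthogonal, so the inner product comes from `π` alone.
  have z₁ : form c (mvfderiv (𝓡 2) a₁ p v) (a₁ p) = 0 := by
    rw [form_comm c (a₁ p)] at k₁; linarith
  have z₂ : form c (mvfderiv (𝓡 2) a₂ p w) (a₂ p) = 0 := by
    rw [form_comm c (a₂ p)] at k₂; linarith
  rw [z₁, zero_smul, zero_add] at e₁
  rw [z₂, zero_smul, add_zero] at e₂
  rw [e₁, e₂]
  -- The factor `c` lets this and the next two relations hold for `c = 0` as well, where `π` need
  -- not be orthogonal to the tangent plane.
  have hπ1 : c * form c (π p) (a₁ p) = 0 := by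
    by_cases hc : c = 0
    · simp [hc]
    · simp only [IsTangent, hc, if_false] at t₁
      simp [t₁]
  have hπ2 : c * form c (π p) (a₂ p) = 0 := by
    by_cases hc : c = 0
    · simp [hc]
    · simp only [IsTangent, hc, if_false] at t₂
      simp [t₂]
  have hππ : c * (c * form c (π p) (π p)) = c := by
    by_cases hc : c = 0
    · simp [hc]
    · rw [hp.2.1 hc]; field_simp
  have o₂₁ : form c (a₂ p) (a₁ p) = 0 := by rw [form_comm, o₁₂]
  have s₁ := form_comm c (a₁ p) (π p)
  have s₂ := form_comm c (a₂ p) (π p)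
  generalize form c (mvfderiv (𝓡 2) a₁ p v) (a₂ p) = x
  generalize form c (mvfderiv (𝓡 2) a₂ p w) (a₁ p) = y
  generalize form c (a₁ p) (mvfderiv (𝓡 2) π p v) = s
  generalize form c (a₂ p) (mvfderiv (𝓡 2) π p w) = t
  simp only [← formL_apply] at *
  simp only [map_sub, map_smul, sub_apply, smul_apply,
    smul_eq_mul, s₂, o₂₁]
  linear_combination s * t * hππ - x * t * hπ2 - y * s * hπ1

end Along

end ProductSurface

namespace ProductSurface

section Surface

variable {M : Type*} [TopologicalSpace M] [ChartedSpace (EuclideanSpace ℝ (Fin 2)) M]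

/-! ### The tangent component -/

section Pointwise

variable {c₁ c₂ : ℝ} {ψ : M → V6} {p : M}

theorem push_add (v w : TangentSpace (𝓡 2) p) : push ψ p (v + w) = push ψ p v + push ψ p w :=
  map_add (mvfderiv (𝓡 2) ψ p) v w

theorem push_sub (v w : TangentSpace (𝓡 2) p) : push ψ p (v - w) = push ψ p v - push ψ p w :=
  map_sub (mvfderiv (𝓡 2) ψ p) v w

theorem push_smul (r : ℝ) (v : TangentSpace (𝓡 2) p) : push ψ p (r • v) = r • push ψ p v :=
  map_smul (mvfderiv (𝓡 2) ψ p) r v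

theorem indMetric_comm (v w : TangentSpace (𝓡 2) p) :
    indMetric c₁ c₂ ψ p v w = indMetric c₁ c₂ ψ p w v := prodMetric_comm _ _ _ _

theorem indMetric_add_left (u v w : TangentSpace (𝓡 2) p) :
    indMetric c₁ c₂ ψ p (u + v) w = indMetric c₁ c₂ ψ p u w + indMetric c₁ c₂ ψ p v w := by
  simp only [indMetric, push_add, prodMetric_add_left]

theorem indMetric_add_right (u v w : TangentSpace (𝓡 2) p) :
    indMetric c₁ c₂ ψ p u (v + w) = indMetric c₁ c₂ ψ p u v + indMetric c₁ c₂ ψ p u w := by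
  simp only [indMetric, push_add, prodMetric_add_right]

theorem indMetric_smul_left (r : ℝ) (v w : TangentSpace (𝓡 2) p) :
    indMetric c₁ c₂ ψ p (r • v) w = r * indMetric c₁ c₂ ψ p v w := by
  simp only [indMetric, push_smul, prodMetric_smul_left]

theorem indMetric_smul_right (r : ℝ) (v w : TangentSpace (𝓡 2) p) :
    indMetric c₁ c₂ ψ p v (r • w) = r * indMetric c₁ c₂ ψ p v w := by
  simp only [indMetric, push_smul, prodMetric_smul_right]

/-- The tangent vectors `u₁, u₂` at `p` are an orthonormal basis of the tangent plane. -/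
structure IsTangentFrameAt (c₁ c₂ : ℝ) (ψ : M → V6) (p : M) (u₁ u₂ : TangentSpace (𝓡 2) p) :
    Prop where
  metric₁₁ : indMetric c₁ c₂ ψ p u₁ u₁ = 1
  metric₂₂ : indMetric c₁ c₂ ψ p u₂ u₂ = 1
  metric₁₂ : indMetric c₁ c₂ ψ p u₁ u₂ = 0

variable {u₁ u₂ : TangentSpace (𝓡 2) p}

namespace IsTangentFrameAt

theorem eq_sum (h : IsTangentFrameAt c₁ c₂ ψ p u₁ u₂) (v : TangentSpace (𝓡 2) p) :
    v = indMetric c₁ c₂ ψ p v u₁ • u₁ + indMetric c₁ c₂ ψ p v u₂ • u₂ := by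
  have h₂₁ : indMetric c₁ c₂ ψ p u₂ u₁ = 0 := by rw [indMetric_comm, h.metric₁₂]
  have hli : LinearIndependent ℝ ![u₁, u₂] := by
    rw [LinearIndependent.pair_iff]
    intro s t hst
    have z : ∀ u, indMetric c₁ c₂ ψ p 0 u = 0 := fun u => by
      have := indMetric_smul_left (c₁ := c₁) (c₂ := c₂) (ψ := ψ) 0 (0 : TangentSpace (𝓡 2) p) u
      simpa using this
    have k₁ := congrArg (fun x => indMetric c₁ c₂ ψ p x u₁) hst
    have k₂ := congrArg (fun x => indMetric c₁ c₂ ψ p x u₂) hst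
    simp only [indMetric_add_left, indMetric_smul_left, h.metric₁₁, h.metric₂₂, h.metric₁₂, h₂₁,
      z] at k₁ k₂
    constructor <;> linarith
  have : FiniteDimensional ℝ (TangentSpace (𝓡 2) p) :=
    inferInstanceAs (FiniteDimensional ℝ (EuclideanSpace ℝ (Fin 2)))
  have hspan := hli.span_eq_top_of_card_eq_finrank' (by
    change _ = Module.finrank ℝ (EuclideanSpace ℝ (Fin 2)); simp)
  have hv : v ∈ Submodule.span ℝ (Set.range ![u₁, u₂]) := by rw [hspan]; trivial
  rw [Matrix.range_cons_cons_empty, Submodule.mem_span_pair] at hv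
  obtain ⟨a, b, rfl⟩ := hv
  simp only [indMetric_add_left, indMetric_smul_left, h.metric₁₁, h.metric₂₂, h.metric₁₂, h₂₁]
  simp

theorem eq_of_forall (h : IsTangentFrameAt c₁ c₂ ψ p u₁ u₂) {v w : TangentSpace (𝓡 2) p}
    (hvw : ∀ z, indMetric c₁ c₂ ψ p v z = indMetric c₁ c₂ ψ p w z) : v = w := by
  rw [h.eq_sum v, h.eq_sum w, hvw, hvw]

/-- `tanPart` is a choice by `epsilon`. The expansion in the frame satisfies its condition, so the
chosen vector does too, and the pairings with the frame then determine it. -/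
theorem tanPart_eq (h : IsTangentFrameAt c₁ c₂ ψ p u₁ u₂) (w : V6) :
    tanPart c₁ c₂ ψ p w =
      prodMetric c₁ c₂ w (push ψ p u₁) • u₁ + prodMetric c₁ c₂ w (push ψ p u₂) • u₂ := by
  have h₂₁ : indMetric c₁ c₂ ψ p u₂ u₁ = 0 := by rw [indMetric_comm, h.metric₁₂]
  have h₁₁ := h.metric₁₁
  have h₂₂ := h.metric₂₂
  have h₁₂ := h.metric₁₂
  unfold indMetric at h₁₁ h₂₂ h₁₂ h₂₁
  have hex : ∃ v : TangentSpace (𝓡 2) p,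
      ∀ z : TangentSpace (𝓡 2) p, prodMetric c₁ c₂ (w - push ψ p v) (push ψ p z) = 0 := by
    refine ⟨prodMetric c₁ c₂ w (push ψ p u₁) • u₁ + prodMetric c₁ c₂ w (push ψ p u₂) • u₂,
      fun z => ?_⟩
    rw [h.eq_sum z]
    simp only [push_add, push_smul, prodMetric_sub_left, prodMetric_add_left, prodMetric_add_right,
      prodMetric_smul_left, prodMetric_smul_right, h₁₁, h₂₂, h₁₂, h₂₁]
    ring
  have hs : ∀ z : TangentSpace (𝓡 2) p,
      prodMetric c₁ c₂ (w - push ψ p (tanPart c₁ c₂ ψ p w)) (push ψ p z) = 0 :=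
    Classical.epsilon_spec hex
  have hs' : ∀ z : TangentSpace (𝓡 2) p,
      indMetric c₁ c₂ ψ p (tanPart c₁ c₂ ψ p w) z = prodMetric c₁ c₂ w (push ψ p z) := by
    intro z
    have := hs z
    rw [prodMetric_sub_left] at this
    exact (sub_eq_zero.1 this).symm
  rw [h.eq_sum (tanPart c₁ c₂ ψ p w), hs', hs']

theorem indMetric_tanPart (h : IsTangentFrameAt c₁ c₂ ψ p u₁ u₂) (w : V6)
    (z : TangentSpace (𝓡 2) p) :
    indMetric c₁ c₂ ψ p (tanPart c₁ c₂ ψ p w) z = prodMetric c₁ c₂ w (push ψ p z) := by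
  rw [h.tanPart_eq, indMetric_add_left, indMetric_smul_left, indMetric_smul_left]
  conv_rhs => rw [h.eq_sum z]
  rw [push_add, push_smul, push_smul, prodMetric_add_right, prodMetric_smul_right,
    prodMetric_smul_right, indMetric_comm u₁, indMetric_comm u₂]
  ring

end IsTangentFrameAt

end Pointwise

/-! ### The Levi-Civita connection of the induced metric -/

variable {c₁ c₂ : ℝ} {ψ : M → V6}

theorem mvfderiv_prodMetric {u v : M → V6} {p : M} (hu : MDifferentiableAt (𝓡 2) 𝓘(ℝ, V6) u p)
    (hv : MDifferentiableAt (𝓡 2) 𝓘(ℝ, V6) v p) (w : TangentSpace (𝓡 2) p) :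
    mvfderiv (𝓡 2) (fun q => prodMetric c₁ c₂ (u q) (v q)) p w =
      prodMetric c₁ c₂ (mvfderiv (𝓡 2) u p w) (v p) +
        prodMetric c₁ c₂ (u p) (mvfderiv (𝓡 2) v p w) :=
  mvfderiv_bilinear_apply (prodMetricL c₁ c₂) hu hv w

variable [IsManifold (𝓡 2) ∞ M]

/-- The field `X` is differentiable at `p`. -/
abbrev DiffFieldAt (X : (q : M) → TangentSpace (𝓡 2) q) (p : M) : Prop :=
  MDifferentiableAt (𝓡 2) (𝓡 2).tangent (fun q => (⟨q, X q⟩ : TangentBundle (𝓡 2) M)) p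

theorem mdifferentiableAt_push (hψ : IsImmersedSurface c₁ c₂ ψ)
    {X : (q : M) → TangentSpace (𝓡 2) q} {p : M} (hX : DiffFieldAt X p) :
    MDifferentiableAt (𝓡 2) 𝓘(ℝ, V6) (fun q => push ψ q (X q)) p :=
  hψ.smooth.contMDiffOn.mdifferentiableAt_mvfderiv_apply isOpen_univ (Set.mem_univ p)
    ENat.LEInfty.out hX

theorem push_mlieBracket (hψ : IsImmersedSurface c₁ c₂ ψ)
    {X Y : (q : M) → TangentSpace (𝓡 2) q} {p : M} (hX : DiffFieldAt X p) (hY : DiffFieldAt Y p) :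
    push ψ p (VectorField.mlieBracket (𝓡 2) X Y p) =
      mvfderiv (𝓡 2) (fun q => push ψ q (Y q)) p (X p) -
        mvfderiv (𝓡 2) (fun q => push ψ q (X q)) p (Y p) :=
  hψ.smooth.contMDiffOn.mvfderiv_mlieBracket isOpen_univ (Set.mem_univ p)
    ENat.LEInfty.out hX hY

/-- The Koszul computation for `D` on the fields `dψ X, dψ Y, dψ Z`: `D` satisfies the product rule
for the flat metric, and brackets become commutators by `push_mlieBracket`, so all terms but two
equal ones cancel. -/
theorem koszul_eq (hψ : IsImmersedSurface c₁ c₂ ψ) {X Y Z : (q : M) → TangentSpace (𝓡 2) q} {p : M}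
    (hX : DiffFieldAt X p) (hY : DiffFieldAt Y p) (hZ : DiffFieldAt Z p) :
    koszul c₁ c₂ ψ X Y Z p =
      2 * prodMetric c₁ c₂ (mvfderiv (𝓡 2) (fun q => push ψ q (Y q)) p (X p)) (push ψ p (Z p)) := by
  have dX := mdifferentiableAt_push hψ hX
  have dY := mdifferentiableAt_push hψ hY
  have dZ := mdifferentiableAt_push hψ hZ
  simp only [koszul, indMetric]
  rw [mvfderiv_prodMetric dY dZ, mvfderiv_prodMetric dX dZ, mvfderiv_prodMetric dX dY,
    push_mlieBracket hψ hX hY, push_mlieBracket hψ hX hZ, push_mlieBracket hψ hY hZ]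
  simp only [prodMetric_sub_left]
  rw [prodMetric_comm _ _ (push ψ p (Y p)), prodMetric_comm _ _ (push ψ p (X p)),
    prodMetric_comm _ _ (push ψ p (X p))]
  ring

/-- The Levi-Civita connection of the induced metric is the tangent component of the flat
derivative. -/
theorem leviCivita_eq_tanPart (hψ : IsImmersedSurface c₁ c₂ ψ) {Y : (q : M) → TangentSpace (𝓡 2) q}
    {p : M} {u₁ u₂ : TangentSpace (𝓡 2) p} (hu : IsTangentFrameAt c₁ c₂ ψ p u₁ u₂)
    (hY : DiffFieldAt Y p) (v : TangentSpace (𝓡 2) p) :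
    leviCivita c₁ c₂ ψ Y p v =
      tanPart c₁ c₂ ψ p (mvfderiv (𝓡 2) (fun q => push ψ q (Y q)) p v) := by
  set w₀ := tanPart c₁ c₂ ψ p (mvfderiv (𝓡 2) (fun q => push ψ q (Y q)) p v) with hw₀
  have hex : ∃ w : TangentSpace (𝓡 2) p, ∀ X Z : (q : M) → TangentSpace (𝓡 2) q,
      DiffFieldAt X p → DiffFieldAt Z p → X p = v →
        2 * indMetric c₁ c₂ ψ p w (Z p) = koszul c₁ c₂ ψ X Y Z p := by
    refine ⟨w₀, fun X Z hX hZ hv => ?_⟩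
    rw [koszul_eq hψ hX hY hZ, hw₀, hu.indMetric_tanPart, hv]
  have hs : ∀ X Z : (q : M) → TangentSpace (𝓡 2) q,
      DiffFieldAt X p → DiffFieldAt Z p → X p = v →
        2 * indMetric c₁ c₂ ψ p (leviCivita c₁ c₂ ψ Y p v) (Z p) = koszul c₁ c₂ ψ X Y Z p :=
    Classical.epsilon_spec hex
  -- The Koszul condition quantifies over fields; it pins down a vector only because every tangent
  -- vector, including `v`, extends to a field differentiable at `p`.
  have hext : ∀ z : TangentSpace (𝓡 2) p, ∃ Z : (q : M) → TangentSpace (𝓡 2) q,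
      DiffFieldAt Z p ∧ Z p = z := fun z =>
    ⟨FiberBundle.extend (EuclideanSpace ℝ (Fin 2)) z,
      FiberBundle.mdifferentiableAt_extend (𝓡 2) (EuclideanSpace ℝ (Fin 2)) z, by simp⟩
  obtain ⟨X, hX, hXv⟩ := hext v
  refine hu.eq_of_forall fun z => ?_
  obtain ⟨Z, hZ, rfl⟩ := hext z
  have h1 := hs X Z hX hZ hXv
  rw [koszul_eq hψ hX hY hZ, hXv] at h1
  rw [hw₀, hu.indMetric_tanPart]
  linarith

end Surface

end ProductSurface

/-! ### Smoothness of the normalizing factor. -/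

section Scalar

variable {E : Type*} [NormedAddCommGroup E] [NormedSpace ℝ E] {H : Type*} [TopologicalSpace H]
  {I : ModelWithCorners ℝ E H} {M : Type*} [TopologicalSpace M] [ChartedSpace H M]

theorem ContMDiffOn.inv_sqrt {n : ℕ∞ω} {f : M → ℝ} {U : Set M}
    (hf : ContMDiffOn I 𝓘(ℝ, ℝ) n f U) (hpos : ∀ q ∈ U, 0 < f q) :
    ContMDiffOn I 𝓘(ℝ, ℝ) n (fun q => (√(f q))⁻¹) U := by
  intro q hq
  have h1 : ContDiffAt ℝ n (fun x : ℝ => (√x)⁻¹) (f q) :=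
    (Real.contDiffAt_sqrt (hpos q hq).ne').inv (Real.sqrt_pos.2 (hpos q hq)).ne'
  exact h1.contMDiffAt.comp_contMDiffWithinAt q (hf q hq)

end Scalar

namespace ProductSurface

/-! ### The product structure, positivity of the induced metric, and smooth eigenframes of `f`. -/

section Surface

variable {M : Type*} [TopologicalSpace M] [ChartedSpace (EuclideanSpace ℝ (Fin 2)) M]
  {c₁ c₂ : ℝ} {ψ : M → V6}

theorem prodStructure_add (v w : V6) :
    prodStructure (v + w) = prodStructure v + prodStructure w := by
  simp [prodStructure, add_comm]

theorem prodStructure_smul (r : ℝ) (v : V6) : prodStructure (r • v) = r • prodStructure v := by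
  simp [prodStructure]

/-- The product structure as a linear map. -/
def prodStructureL : V6 →L[ℝ] V6 :=
  (ContinuousLinearMap.fst ℝ V3 V3).prod (-ContinuousLinearMap.snd ℝ V3 V3)

theorem prodMetric_prodStructure (v w : V6) :
    prodMetric c₁ c₂ (prodStructure v) w = form c₁ v.1 w.1 - form c₂ v.2 w.2 := by
  simp only [prodMetric, prodStructure, ← formL_apply]
  simp [sub_eq_add_neg]

theorem prodMetric_prodStructure_comm (v w : V6) :
    prodMetric c₁ c₂ (prodStructure v) w = prodMetric c₁ c₂ (prodStructure w) v := by
  rw [prodMetric_prodStructure, prodMetric_prodStructure, form_comm, form_comm c₂]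

theorem isTangent_push_fst (hψ : IsImmersedSurface c₁ c₂ ψ) {p : M} (v : TangentSpace (𝓡 2) p) :
    IsTangent c₁ (ψ p).1 (push ψ p v).1 := by
  have hd := (hψ.smooth p).mdifferentiableAt (by simp)
  have h1 := mvfderiv_clm_comp (ContinuousLinearMap.fst ℝ V3 V3) hd v
  have h2 := isTangent_mvfderiv (π := fun q => (ψ q).1)
    ((ContinuousLinearMap.fst ℝ V3 V3).mdifferentiableAt.comp p hd)
    (Filter.Eventually.of_forall hψ.mem_fst) v
  change mvfderiv (𝓡 2) (fun q => (ψ q).1) p v = (push ψ p v).1 at h1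
  rwa [h1] at h2

theorem isTangent_push_snd (hψ : IsImmersedSurface c₁ c₂ ψ) {p : M} (v : TangentSpace (𝓡 2) p) :
    IsTangent c₂ (ψ p).2 (push ψ p v).2 := by
  have hd := (hψ.smooth p).mdifferentiableAt (by simp)
  have h1 := mvfderiv_clm_comp (ContinuousLinearMap.snd ℝ V3 V3) hd v
  have h2 := isTangent_mvfderiv (π := fun q => (ψ q).2)
    ((ContinuousLinearMap.snd ℝ V3 V3).mdifferentiableAt.comp p hd)
    (Filter.Eventually.of_forall hψ.mem_snd) v
  change mvfderiv (𝓡 2) (fun q => (ψ q).2) p v = (push ψ p v).2 at h1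
  rwa [h1] at h2

theorem form_zero_zero (c : ℝ) : form c 0 0 = 0 := by simp [form]

theorem indMetric_self_pos (hψ : IsImmersedSurface c₁ c₂ ψ) {p : M} {v : TangentSpace (𝓡 2) p}
    (hv : v ≠ 0) : 0 < indMetric c₁ c₂ ψ p v v := by
  have hne : push ψ p v ≠ 0 := fun h =>
    hv (hψ.injective p (h.trans (map_zero (mvfderiv (𝓡 2) ψ p)).symm))
  have t₁ := isTangent_push_fst hψ v
  have t₂ := isTangent_push_snd hψ v
  unfold indMetric prodMetric
  by_cases h1 : (push ψ p v).1 = 0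
  · have h2 : (push ψ p v).2 ≠ 0 := fun h2 => hne (Prod.ext h1 h2)
    rw [h1, form_zero_zero, zero_add]
    exact form_self_pos (hψ.mem_snd p) t₂ h2
  · have k₁ := form_self_pos (hψ.mem_fst p) t₁ h1
    by_cases h2 : (push ψ p v).2 = 0
    · rwa [h2, form_zero_zero, add_zero]
    · exact add_pos k₁ (form_self_pos (hψ.mem_snd p) t₂ h2)

/-- Turns an eigenvector of `f` into one of the symmetric matrix of `F` in an orthonormal frame,
whose entries are smooth functions. -/
theorem exists_eigenvector_coords {p : M} {u₁ u₂ : TangentSpace (𝓡 2) p} {lam : ℝ}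
    (hu : IsTangentFrameAt c₁ c₂ ψ p u₁ u₂) (h : IsEigenvalueAt c₁ c₂ ψ p lam) :
    ∃ x y : ℝ, (x ≠ 0 ∨ y ≠ 0) ∧
      x * prodMetric c₁ c₂ (prodStructure (push ψ p u₁)) (push ψ p u₁) +
        y * prodMetric c₁ c₂ (prodStructure (push ψ p u₁)) (push ψ p u₂) = lam * x ∧
      x * prodMetric c₁ c₂ (prodStructure (push ψ p u₁)) (push ψ p u₂) +
        y * prodMetric c₁ c₂ (prodStructure (push ψ p u₂)) (push ψ p u₂) = lam * y := by
  obtain ⟨v, hv, hfv⟩ := h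
  have hsum := hu.eq_sum v
  set x := indMetric c₁ c₂ ψ p v u₁ with hx
  set y := indMetric c₁ c₂ ψ p v u₂ with hy
  have key : ∀ u, prodMetric c₁ c₂ (prodStructure (push ψ p v)) (push ψ p u) =
      lam * indMetric c₁ c₂ ψ p v u := by
    intro u
    rw [← indMetric_smul_left, ← hfv, fTensor, hu.indMetric_tanPart]
  have k₁ := key u₁
  have k₂ := key u₂
  rw [← hx, hsum] at k₁
  rw [← hy, hsum] at k₂
  simp only [push_add, push_smul, prodStructure_add, prodStructure_smul, prodMetric_add_left,
    prodMetric_smul_left] at k₁ k₂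
  rw [prodMetric_prodStructure_comm (push ψ p u₂)] at k₁
  refine ⟨x, y, ?_, k₁, k₂⟩
  by_contra! h0
  rw [h0.1, h0.2] at hsum
  exact hv (by simpa using hsum)

variable [IsManifold (𝓡 2) ∞ M]

/-! ### Smooth tangent fields -/

theorem IsTangentField.diffFieldAt {X : (q : M) → TangentSpace (𝓡 2) q} {U : Set M} {p : M}
    (hX : IsTangentField X U) (hU : IsOpen U) (hp : p ∈ U) : DiffFieldAt X p :=
  (hX.contMDiffAt (hU.mem_nhds hp)).mdifferentiableAt (by simp)

theorem contMDiffOn_push (hψ : IsImmersedSurface c₁ c₂ ψ) {X : (q : M) → TangentSpace (𝓡 2) q}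
    {U : Set M} (hU : IsOpen U) (hX : IsTangentField X U) :
    ContMDiffOn (𝓡 2) 𝓘(ℝ, V6) ∞ (fun q => push ψ q (X q)) U :=
  hψ.smooth.contMDiffOn.mvfderiv_apply hU hX (by simp)

theorem contMDiffOn_indMetric (hψ : IsImmersedSurface c₁ c₂ ψ)
    {X Y : (q : M) → TangentSpace (𝓡 2) q} {U : Set M} (hU : IsOpen U) (hX : IsTangentField X U)
    (hY : IsTangentField Y U) :
    ContMDiffOn (𝓡 2) 𝓘(ℝ, ℝ) ∞ (fun q => indMetric c₁ c₂ ψ q (X q) (Y q)) U :=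
  (contMDiffOn_push hψ hU hX).bilinear_apply (prodMetricL c₁ c₂) (contMDiffOn_push hψ hU hY)

theorem IsTangentField.smul_add_smul {X Y : (q : M) → TangentSpace (𝓡 2) q} {f g : M → ℝ}
    {U : Set M} (hf : ContMDiffOn (𝓡 2) 𝓘(ℝ, ℝ) ∞ f U) (hX : IsTangentField X U)
    (hg : ContMDiffOn (𝓡 2) 𝓘(ℝ, ℝ) ∞ g U) (hY : IsTangentField Y U) :
    IsTangentField (fun q => f q • X q + g q • Y q) U :=
  ContMDiffOn.add_section (hf.smul_section hX) (hg.smul_section hY)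

/-- A smooth field that does not vanish at a point can be normalized near that point. -/
theorem IsTangentField.exists_normalized (hψ : IsImmersedSurface c₁ c₂ ψ)
    {X : (q : M) → TangentSpace (𝓡 2) q} {U : Set M} (hU : IsOpen U) (hX : IsTangentField X U)
    {p : M} (hp : p ∈ U) (hXp : X p ≠ 0) :
    ∃ V ⊆ U, IsOpen V ∧ p ∈ V ∧ ∃ r : M → ℝ, ContMDiffOn (𝓡 2) 𝓘(ℝ, ℝ) ∞ r V ∧
      IsTangentField (fun q => r q • X q) V ∧
        ∀ q ∈ V, indMetric c₁ c₂ ψ q (r q • X q) (r q • X q) = 1 := by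
  have hg := contMDiffOn_indMetric hψ hU hX hX
  have hV := hg.continuousOn.isOpen_inter_preimage hU (isOpen_Ioi (a := (0 : ℝ)))
  have hr := (hg.mono Set.inter_subset_left).inv_sqrt
    (U := U ∩ (fun q => indMetric c₁ c₂ ψ q (X q) (X q)) ⁻¹' Set.Ioi 0) fun q hq => hq.2
  refine ⟨_, Set.inter_subset_left, hV, ⟨hp, indMetric_self_pos hψ hXp⟩, _, hr,
    hr.smul_section (hX.mono Set.inter_subset_left), fun q hq => ?_⟩
  have h0 : 0 < indMetric c₁ c₂ ψ q (X q) (X q) := hq.2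
  have h1 := Real.mul_self_sqrt h0.le
  have h2 := (Real.sqrt_pos.2 h0).ne'
  rw [indMetric_smul_left, indMetric_smul_right]
  field_simp
  nlinarith

theorem exists_isTangentField_apply_eq {p : M} (v : TangentSpace (𝓡 2) p) :
    ∃ (X : (q : M) → TangentSpace (𝓡 2) q) (U : Set M), IsOpen U ∧ p ∈ U ∧ IsTangentField X U ∧
      X p = v := by
  obtain ⟨s, hs, h⟩ := FiberBundle.exists_contMDiffOn_extend (k := ∞) (𝓡 2)
    (EuclideanSpace ℝ (Fin 2)) v
  obtain ⟨U, hUs, hU, hp⟩ := mem_nhds_iff.1 hs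
  exact ⟨_, U, hU, hp, h.mono hUs, by simp⟩

/-- Near every point there is a smooth orthonormal frame. -/
theorem exists_tangentFrame (hψ : IsImmersedSurface c₁ c₂ ψ) (p : M) :
    ∃ (U : Set M) (u₁ u₂ : (q : M) → TangentSpace (𝓡 2) q), IsOpen U ∧ p ∈ U ∧
      IsTangentField u₁ U ∧ IsTangentField u₂ U ∧
        ∀ q ∈ U, IsTangentFrameAt c₁ c₂ ψ q (u₁ q) (u₂ q) := by
  obtain ⟨X, U₁, hU₁, hp₁, hX, hXp⟩ := exists_isTangentField_apply_eq (p := p)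
    (EuclideanSpace.single (0 : Fin 2) (1 : ℝ) : EuclideanSpace ℝ (Fin 2))
  obtain ⟨Y, U₂, hU₂, hp₂, hY, hYp⟩ := exists_isTangentField_apply_eq (p := p)
    (EuclideanSpace.single (1 : Fin 2) (1 : ℝ) : EuclideanSpace ℝ (Fin 2))
  have hXp0 : X p ≠ 0 := by
    intro h
    rw [hXp] at h
    have := congrArg (fun v : EuclideanSpace ℝ (Fin 2) => v 0) h
    simp only [PiLp.single_apply, if_true] at this
    exact one_ne_zero this
  obtain ⟨V, hVU, hV, hpV, r, -, hu, hu1⟩ := hX.exists_normalized hψ hU₁ hp₁ hXp0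
  have hW := hV.inter hU₂
  have hu' := hu.mono (Set.inter_subset_left (t := U₂))
  have hY' := hY.mono (Set.inter_subset_right (s := V))
  have hm := contMDiffOn_indMetric hψ hW hY' hu'
  -- Gram-Schmidt: `Y` minus its component along the normalized `X`.
  have hZ : IsTangentField (fun q => (1 : ℝ) • Y q +
      (-indMetric c₁ c₂ ψ q (Y q) (r q • X q)) • (r q • X q)) (V ∩ U₂) :=
    IsTangentField.smul_add_smul contMDiffOn_const hY' hm.neg hu'
  -- At `p` the fields `X, Y` are the two standard basis vectors, so the second coordinate of the
  -- new field is `1` and it does not vanish.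
  obtain ⟨W, hWV, hWo, hpW, s, hs, hw, hw1⟩ := hZ.exists_normalized hψ hW ⟨hpV, hp₂⟩ (by
    intro h
    have h' : (1 : ℝ) • (EuclideanSpace.single (1 : Fin 2) (1 : ℝ) : EuclideanSpace ℝ (Fin 2)) +
        (-indMetric c₁ c₂ ψ p (Y p) (r p • X p)) •
          (r p • (EuclideanSpace.single (0 : Fin 2) (1 : ℝ) : EuclideanSpace ℝ (Fin 2))) = 0 := by
      rw [← hYp, ← hXp]
      exact h
    have := congrArg (fun v : EuclideanSpace ℝ (Fin 2) => v 1) h'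
    simp at this)
  refine ⟨W, _, _, hWo, hpW, hu'.mono hWV, hw, fun q hq => ⟨hu1 q (hWV hq).1, hw1 q hq, ?_⟩⟩
  rw [indMetric_smul_right, indMetric_add_right, indMetric_smul_right,
    indMetric_smul_right _ (r q • X q),
    hu1 q (hWV hq).1, indMetric_comm (Y q)]
  ring

/-! ### The adapted frame -/

/-- `e₁, e₂` is a smooth orthonormal frame on `U` that diagonalizes `f` with eigenvalues
`lam₁, lam₂`. -/
structure IsEigenframeOn (c₁ c₂ : ℝ) (ψ : M → V6) (lam₁ lam₂ : ℝ) (U : Set M)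
    (e₁ e₂ : (q : M) → TangentSpace (𝓡 2) q) : Prop where
  isOpen : IsOpen U
  field₁ : IsTangentField e₁ U
  field₂ : IsTangentField e₂ U
  frame : ∀ q ∈ U, IsTangentFrameAt c₁ c₂ ψ q (e₁ q) (e₂ q)
  eigen₁₁ : ∀ q ∈ U,
    prodMetric c₁ c₂ (prodStructure (push ψ q (e₁ q))) (push ψ q (e₁ q)) = lam₁
  eigen₂₂ : ∀ q ∈ U,
    prodMetric c₁ c₂ (prodStructure (push ψ q (e₂ q))) (push ψ q (e₂ q)) = lam₂
  eigen₁₂ : ∀ q ∈ U, prodMetric c₁ c₂ (prodStructure (push ψ q (e₁ q))) (push ψ q (e₂ q)) = 0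

/-- Let `S` be the matrix of `f` in a smooth orthonormal frame. By Cayley-Hamilton `S - lam₂` maps
every vector into the `lam₁`-eigenline, so applying it to a vector with constant coordinates gives a
smooth eigenfield wherever the result is nonzero. -/
theorem exists_isEigenframeOn (hψ : IsImmersedSurface c₁ c₂ ψ) {lam₁ lam₂ : ℝ} (hlam : lam₁ ≠ lam₂)
    (hf : ∀ p, IsEigenvalueAt c₁ c₂ ψ p lam₁ ∧ IsEigenvalueAt c₁ c₂ ψ p lam₂) (p₀ : M) :
    ∃ (U : Set M) (e₁ e₂ : (q : M) → TangentSpace (𝓡 2) q), p₀ ∈ U ∧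
      IsEigenframeOn c₁ c₂ ψ lam₁ lam₂ U e₁ e₂ := by
  obtain ⟨U, u₁, u₂, hU, hp, hu₁, hu₂, hu⟩ := exists_tangentFrame hψ p₀
  have s₁ := contMDiffOn_push hψ hU hu₁
  have s₂ := contMDiffOn_push hψ hU hu₂
  set A : M → ℝ := fun q =>
    prodMetric c₁ c₂ (prodStructure (push ψ q (u₁ q))) (push ψ q (u₁ q)) with hA
  set B : M → ℝ := fun q =>
    prodMetric c₁ c₂ (prodStructure (push ψ q (u₁ q))) (push ψ q (u₂ q)) with hB
  set D : M → ℝ := fun q =>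
    prodMetric c₁ c₂ (prodStructure (push ψ q (u₂ q))) (push ψ q (u₂ q)) with hD
  have sA : ContMDiffOn (𝓡 2) 𝓘(ℝ, ℝ) ∞ A U :=
    s₁.bilinear_apply ((prodMetricL c₁ c₂).comp prodStructureL) s₁
  have sB : ContMDiffOn (𝓡 2) 𝓘(ℝ, ℝ) ∞ B U :=
    s₁.bilinear_apply ((prodMetricL c₁ c₂).comp prodStructureL) s₂
  have sD : ContMDiffOn (𝓡 2) 𝓘(ℝ, ℝ) ∞ D U :=
    s₂.bilinear_apply ((prodMetricL c₁ c₂).comp prodStructureL) s₂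
  -- Both eigenvalues are roots of the characteristic polynomial; subtracting the two equations
  -- gives the trace.
  have hchar : ∀ q ∈ U, A q + D q = lam₁ + lam₂ ∧ B q ^ 2 = (A q - lam₁) * (D q - lam₁) := by
    intro q hq
    have hdet : ∀ lam, IsEigenvalueAt c₁ c₂ ψ q lam → B q ^ 2 = (A q - lam) * (D q - lam) := by
      intro lam h
      obtain ⟨x, y, hxy, k₁, k₂⟩ := exists_eigenvector_coords (hu q hq) h
      change x * A q + y * B q = lam * x at k₁
      change x * B q + y * D q = lam * y at k₂
      rcases hxy with hx | hy
      · refine mul_left_cancel₀ hx ?_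
        linear_combination B q * k₂ - (D q - lam) * k₁
      · refine mul_left_cancel₀ hy ?_
        linear_combination B q * k₁ - (A q - lam) * k₂
    have d₁ := hdet _ (hf q).1
    have d₂ := hdet _ (hf q).2
    refine ⟨mul_left_cancel₀ (sub_ne_zero.2 hlam) ?_, d₁⟩
    linear_combination d₁ - d₂
  obtain ⟨x, y, hxy, k₁, k₂⟩ := exists_eigenvector_coords (hu p₀ hp) (hf p₀).1
  change x * A p₀ + y * B p₀ = lam₁ * x at k₁
  change x * B p₀ + y * D p₀ = lam₁ * y at k₂
  -- `(a, b)` is `S - lam₂` applied to the constant `(x, y)`, a `lam₁`-eigenvector at `p₀`. There it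
  -- equals `(lam₁ - lam₂) (x, y)`, which is nonzero.
  set a : M → ℝ := fun q => x * (A q - lam₂) + y * B q with ha
  set b : M → ℝ := fun q => x * B q + y * (D q - lam₂) with hb
  have sa : ContMDiffOn (𝓡 2) 𝓘(ℝ, ℝ) ∞ a U :=
    (contMDiffOn_const.mul (sA.sub contMDiffOn_const)).add (contMDiffOn_const.mul sB)
  have sb : ContMDiffOn (𝓡 2) 𝓘(ℝ, ℝ) ∞ b U :=
    (contMDiffOn_const.mul sB).add (contMDiffOn_const.mul (sD.sub contMDiffOn_const))
  have sN : ContMDiffOn (𝓡 2) 𝓘(ℝ, ℝ) ∞ (fun q => a q * a q + b q * b q) U :=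
    (sa.mul sa).add (sb.mul sb)
  set V := U ∩ (fun q => a q * a q + b q * b q) ⁻¹' Set.Ioi 0 with hV
  have hVo : IsOpen V := sN.continuousOn.isOpen_inter_preimage hU isOpen_Ioi
  have hVU : V ⊆ U := Set.inter_subset_left
  have hpV : p₀ ∈ V := by
    refine ⟨hp, ?_⟩
    have e1 : a p₀ = (lam₁ - lam₂) * x := by simp only [ha]; linear_combination k₁
    have e2 : b p₀ = (lam₁ - lam₂) * y := by simp only [hb]; linear_combination k₂
    have h0 := sub_ne_zero.2 hlam
    change 0 < a p₀ * a p₀ + b p₀ * b p₀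
    rw [e1, e2]
    rcases hxy with h | h
    · have := mul_self_pos.2 (mul_ne_zero h0 h)
      nlinarith [mul_self_nonneg ((lam₁ - lam₂) * y)]
    · have := mul_self_pos.2 (mul_ne_zero h0 h)
      nlinarith [mul_self_nonneg ((lam₁ - lam₂) * x)]
  have sr := (sN.mono hVU).inv_sqrt fun q hq => hq.2
  set r : M → ℝ := fun q => (√(a q * a q + b q * b q))⁻¹ with hr
  have hrr : ∀ q ∈ V, r q ^ 2 * (a q * a q + b q * b q) = 1 := by
    intro q hq
    have h0 : 0 < a q * a q + b q * b q := hq.2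
    simp only [hr, inv_pow, Real.sq_sqrt h0.le]
    exact inv_mul_cancel₀ h0.ne'
  have sρ : ContMDiffOn (𝓡 2) 𝓘(ℝ, ℝ) ∞ (fun q => r q * a q) V := sr.mul (sa.mono hVU)
  have sσ : ContMDiffOn (𝓡 2) 𝓘(ℝ, ℝ) ∞ (fun q => r q * b q) V := sr.mul (sb.mono hVU)
  -- Cayley-Hamilton: `(S - lam₁) (S - lam₂) = 0`.
  have hlin : ∀ q ∈ V, A q * a q + B q * b q = lam₁ * a q ∧ B q * a q + D q * b q = lam₁ * b q := by
    intro q hq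
    obtain ⟨h1, h2⟩ := hchar q (hVU hq)
    simp only [ha, hb]
    constructor
    · linear_combination x * h2 + (y * B q + x * (A q - lam₁)) * h1
    · linear_combination y * h2 + (x * B q + y * (D q - lam₁)) * h1
  have hframe := fun q hq => hu q (hVU hq)
  have hcomm : ∀ q, prodMetric c₁ c₂ (prodStructure (push ψ q (u₂ q))) (push ψ q (u₁ q)) = B q :=
    fun q => prodMetric_prodStructure_comm _ _
  -- The second field is the first turned by a right angle; its eigenvalue is the trace minus
  -- `lam₁`.
  refine ⟨V, fun q => (r q * a q) • u₁ q + (r q * b q) • u₂ q,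
    fun q => (-(r q * b q)) • u₁ q + (r q * a q) • u₂ q, hpV, hVo,
    IsTangentField.smul_add_smul sρ (hu₁.mono hVU) sσ (hu₂.mono hVU),
    IsTangentField.smul_add_smul sσ.neg (hu₁.mono hVU) sρ (hu₂.mono hVU), fun q hq => ?_,
    fun q hq => ?_, fun q hq => ?_, fun q hq => ?_⟩
  · have h := hframe q hq
    have h₂₁ : indMetric c₁ c₂ ψ q (u₂ q) (u₁ q) = 0 := by rw [indMetric_comm, h.metric₁₂]
    constructor <;>
      simp only [indMetric_add_left, indMetric_add_right, indMetric_smul_left,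
        indMetric_smul_right, h.metric₁₁, h.metric₂₂, h.metric₁₂, h₂₁]
    · linear_combination hrr q hq
    · linear_combination hrr q hq
    · ring
  all_goals
    simp only [push_add, push_smul, prodStructure_add, prodStructure_smul, prodMetric_add_left,
      prodMetric_add_right, prodMetric_smul_left, prodMetric_smul_right, hcomm]
    change _ * (_ * A q + _ * B q) + _ * (_ * B q + _ * D q) = _
    obtain ⟨h1, h2⟩ := hlin q hq
    have h3 := (hchar q (hVU hq)).1
    have h4 := hrr q hq
  · linear_combination r q ^ 2 * a q * h1 + r q ^ 2 * b q * h2 + lam₁ * h4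
  · linear_combination -r q ^ 2 * a q * h1 - r q ^ 2 * b q * h2 +
      r q ^ 2 * (a q * a q + b q * b q) * h3 + lam₂ * h4
  · linear_combination r q ^ 2 * a q * h2 - r q ^ 2 * b q * h1

end Surface

end ProductSurface

namespace ProductSurface

section Surface

variable {M : Type*} [TopologicalSpace M] [ChartedSpace (EuclideanSpace ℝ (Fin 2)) M]
  {c₁ c₂ : ℝ} {ψ : M → V6}

theorem mvfderiv_prod_smul {a b : M → V3} {p : M} (ha : MDifferentiableAt (𝓡 2) 𝓘(ℝ, V3) a p)
    (hb : MDifferentiableAt (𝓡 2) 𝓘(ℝ, V3) b p) (x y : ℝ) (v : TangentSpace (𝓡 2) p) :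
    mvfderiv (𝓡 2) (fun q => (x • a q, y • b q)) p v =
      (x • mvfderiv (𝓡 2) a p v, y • mvfderiv (𝓡 2) b p v) := by
  have hab := ha.prodMk_space hb
  have h₁ : mvfderiv (𝓡 2) a p v = (mvfderiv (𝓡 2) (fun q => (a q, b q)) p v).1 :=
    mvfderiv_clm_comp (ContinuousLinearMap.fst ℝ V3 V3) hab v
  have h₂ : mvfderiv (𝓡 2) b p v = (mvfderiv (𝓡 2) (fun q => (a q, b q)) p v).2 :=
    mvfderiv_clm_comp (ContinuousLinearMap.snd ℝ V3 V3) hab v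
  rw [h₁, h₂]
  exact mvfderiv_clm_comp ((x • ContinuousLinearMap.fst ℝ V3 V3).prod
    (y • ContinuousLinearMap.snd ℝ V3 V3)) hab v

theorem isTangent_ambientConn_fst (hψ : IsImmersedSurface c₁ c₂ ψ) (ξ : M → V6) (p : M)
    (v : TangentSpace (𝓡 2) p) : IsTangent c₁ (ψ p).1 (ambientConn c₁ c₂ ψ ξ p v).1 :=
  isTangent_tangentProj (hψ.mem_fst p) _

theorem isTangent_ambientConn_snd (hψ : IsImmersedSurface c₁ c₂ ψ) (ξ : M → V6) (p : M)
    (v : TangentSpace (𝓡 2) p) : IsTangent c₂ (ψ p).2 (ambientConn c₁ c₂ ψ ξ p v).2 :=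
  isTangent_tangentProj (hψ.mem_snd p) _

/-- Lets the flat derivative stand in for `∇̃` in every pairing with a vector tangent to the
product. -/
theorem prodMetric_ambientConn (hψ : IsImmersedSurface c₁ c₂ ψ) (ξ : M → V6) (p : M)
    (v : TangentSpace (𝓡 2) p) {w : V6} (hw₁ : IsTangent c₁ (ψ p).1 w.1)
    (hw₂ : IsTangent c₂ (ψ p).2 w.2) :
    prodMetric c₁ c₂ (ambientConn c₁ c₂ ψ ξ p v) w = prodMetric c₁ c₂ (mvfderiv (𝓡 2) ξ p v) w :=
  congrArg₂ (· + ·) (form_tangentProj (hψ.mem_fst p) hw₁ _) (form_tangentProj (hψ.mem_snd p) hw₂ _)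

variable [IsManifold (𝓡 2) ∞ M]

/-! ### Adapted frames -/

/-- `e₁, e₂` is a smooth tangent frame on `U` with components
`eᵢ = cos θᵢ aᵢ + sin θᵢ bᵢ`, where `a₁, a₂` and `b₁, b₂` are smooth orthonormal frames of the
tangent planes of `M²(c₁)` and `M²(c₂)` along `ψ`. -/
structure IsAdaptedFrameOn (c₁ c₂ : ℝ) (ψ : M → V6) (θ₁ θ₂ : ℝ) (U : Set M)
    (e₁ e₂ : (q : M) → TangentSpace (𝓡 2) q) (a₁ a₂ b₁ b₂ : M → V3) : Prop where
  isOpen : IsOpen U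
  field₁ : IsTangentField e₁ U
  field₂ : IsTangentField e₂ U
  smooth_a₁ : ContMDiffOn (𝓡 2) 𝓘(ℝ, V3) ∞ a₁ U
  smooth_a₂ : ContMDiffOn (𝓡 2) 𝓘(ℝ, V3) ∞ a₂ U
  smooth_b₁ : ContMDiffOn (𝓡 2) 𝓘(ℝ, V3) ∞ b₁ U
  smooth_b₂ : ContMDiffOn (𝓡 2) 𝓘(ℝ, V3) ∞ b₂ U
  push₁ : ∀ q ∈ U, push ψ q (e₁ q) = (Real.cos θ₁ • a₁ q, Real.sin θ₁ • b₁ q)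
  push₂ : ∀ q ∈ U, push ψ q (e₂ q) = (Real.cos θ₂ • a₂ q, Real.sin θ₂ • b₂ q)
  tangent_a₁ : ∀ q ∈ U, IsTangent c₁ (ψ q).1 (a₁ q)
  tangent_a₂ : ∀ q ∈ U, IsTangent c₁ (ψ q).1 (a₂ q)
  tangent_b₁ : ∀ q ∈ U, IsTangent c₂ (ψ q).2 (b₁ q)
  tangent_b₂ : ∀ q ∈ U, IsTangent c₂ (ψ q).2 (b₂ q)
  form_a₁₁ : ∀ q ∈ U, form c₁ (a₁ q) (a₁ q) = 1
  form_a₂₂ : ∀ q ∈ U, form c₁ (a₂ q) (a₂ q) = 1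
  form_a₁₂ : ∀ q ∈ U, form c₁ (a₁ q) (a₂ q) = 0
  form_b₁₁ : ∀ q ∈ U, form c₂ (b₁ q) (b₁ q) = 1
  form_b₂₂ : ∀ q ∈ U, form c₂ (b₂ q) (b₂ q) = 1
  form_b₁₂ : ∀ q ∈ U, form c₂ (b₁ q) (b₂ q) = 0

/-- The normal field `ξ = sin θ a - cos θ b` associated with `e = cos θ a + sin θ b`. -/
def adaptedNormal (θ : ℝ) (a b : M → V3) (q : M) : V6 := (Real.sin θ • a q, -Real.cos θ • b q)

theorem form_smul_smul (c r s : ℝ) (v w : V3) : form c (r • v) (s • w) = r * s * form c v w := by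
  rw [form_smul_left, form_smul_right, mul_assoc]

/-- Half the sum and half the difference of the pairings with and without `F` are the pairings in
the factors. For an eigenframe they are `(1 ± cos 2θᵢ) / 2`, that is `cos² θᵢ` and `sin² θᵢ`, on the
diagonal and `0` off it; dividing the components by `cos θᵢ` and `sin θᵢ` gives the frames. -/
theorem exists_isAdaptedFrameOn (hψ : IsImmersedSurface c₁ c₂ ψ) {θ₁ θ₂ : ℝ}
    (hC₁ : 0 < Real.cos θ₁) (hC₂ : 0 < Real.cos θ₂) (hS₁ : 0 < Real.sin θ₁) (hS₂ : 0 < Real.sin θ₂)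
    (hlam : Real.cos (2 * θ₁) ≠ Real.cos (2 * θ₂))
    (hf : ∀ p, IsEigenvalueAt c₁ c₂ ψ p (Real.cos (2 * θ₁)) ∧
      IsEigenvalueAt c₁ c₂ ψ p (Real.cos (2 * θ₂))) (p₀ : M) :
    ∃ (U : Set M) (e₁ e₂ : (q : M) → TangentSpace (𝓡 2) q) (a₁ a₂ b₁ b₂ : M → V3), p₀ ∈ U ∧
      IsAdaptedFrameOn c₁ c₂ ψ θ₁ θ₂ U e₁ e₂ a₁ a₂ b₁ b₂ := by
  obtain ⟨U, e₁, e₂, hp, h⟩ := exists_isEigenframeOn hψ hlam hf p₀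
  have s₁ := contMDiffOn_push hψ h.isOpen h.field₁
  have s₂ := contMDiffOn_push hψ h.isOpen h.field₂
  have hfst : ∀ {u : M → V6} (r : ℝ), ContMDiffOn (𝓡 2) 𝓘(ℝ, V6) ∞ u U →
      ContMDiffOn (𝓡 2) 𝓘(ℝ, V3) ∞ (fun q => r • (u q).1) U := fun r hu =>
    (r • ContinuousLinearMap.fst ℝ V3 V3).contMDiff.comp_contMDiffOn hu
  have hsnd : ∀ {u : M → V6} (r : ℝ), ContMDiffOn (𝓡 2) 𝓘(ℝ, V6) ∞ u U →
      ContMDiffOn (𝓡 2) 𝓘(ℝ, V3) ∞ (fun q => r • (u q).2) U := fun r hu =>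
    (r • ContinuousLinearMap.snd ℝ V3 V3).contMDiff.comp_contMDiffOn hu
  have split : ∀ {v w : V6} {x y : ℝ}, prodMetric c₁ c₂ v w = x →
      prodMetric c₁ c₂ (prodStructure v) w = y →
      form c₁ v.1 w.1 = (x + y) / 2 ∧ form c₂ v.2 w.2 = (x - y) / 2 := by
    intro v w x y h1 h2
    rw [prodMetric_prodStructure] at h2
    rw [prodMetric] at h1
    constructor <;> linarith
  have k₁₁ := fun q hq => split (h.frame q hq).metric₁₁ (h.eigen₁₁ q hq)
  have k₂₂ := fun q hq => split (h.frame q hq).metric₂₂ (h.eigen₂₂ q hq)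
  have k₁₂ := fun q hq => split (h.frame q hq).metric₁₂ (h.eigen₁₂ q hq)
  have q₁ := Real.sin_sq_add_cos_sq θ₁
  have q₂ := Real.sin_sq_add_cos_sq θ₂
  have t₁ := Real.cos_two_mul θ₁
  have t₂ := Real.cos_two_mul θ₂
  refine ⟨U, e₁, e₂, _, _, _, _, hp, h.isOpen, h.field₁, h.field₂, hfst (Real.cos θ₁)⁻¹ s₁,
    hfst (Real.cos θ₂)⁻¹ s₂, hsnd (Real.sin θ₁)⁻¹ s₁, hsnd (Real.sin θ₂)⁻¹ s₂, fun q hq => ?_,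
    fun q hq => ?_, fun q hq => isTangent_smul _ (isTangent_push_fst hψ _),
    fun q hq => isTangent_smul _ (isTangent_push_fst hψ _),
    fun q hq => isTangent_smul _ (isTangent_push_snd hψ _),
    fun q hq => isTangent_smul _ (isTangent_push_snd hψ _), fun q hq => ?_, fun q hq => ?_,
    fun q hq => ?_, fun q hq => ?_, fun q hq => ?_, fun q hq => ?_⟩
  · rw [smul_inv_smul₀ hC₁.ne', smul_inv_smul₀ hS₁.ne']
  · rw [smul_inv_smul₀ hC₂.ne', smul_inv_smul₀ hS₂.ne']
  · rw [form_smul_smul, (k₁₁ q hq).1]; field_simp; linarith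
  · rw [form_smul_smul, (k₂₂ q hq).1]; field_simp; linarith
  · rw [form_smul_smul, (k₁₂ q hq).1]; simp
  · rw [form_smul_smul, (k₁₁ q hq).2]; field_simp; linarith
  · rw [form_smul_smul, (k₂₂ q hq).2]; field_simp; linarith
  · rw [form_smul_smul, (k₁₂ q hq).2]; simp

namespace IsAdaptedFrameOn

variable {θ₁ θ₂ : ℝ} {U : Set M} {e₁ e₂ : (q : M) → TangentSpace (𝓡 2) q} {a₁ a₂ b₁ b₂ : M → V3}

theorem form_a₂₁ (h : IsAdaptedFrameOn c₁ c₂ ψ θ₁ θ₂ U e₁ e₂ a₁ a₂ b₁ b₂) {q : M} (hq : q ∈ U) :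
    form c₁ (a₂ q) (a₁ q) = 0 := by rw [form_comm, h.form_a₁₂ q hq]

theorem form_b₂₁ (h : IsAdaptedFrameOn c₁ c₂ ψ θ₁ θ₂ U e₁ e₂ a₁ a₂ b₁ b₂) {q : M} (hq : q ∈ U) :
    form c₂ (b₂ q) (b₁ q) = 0 := by rw [form_comm, h.form_b₁₂ q hq]

theorem isTangentFrameAt (h : IsAdaptedFrameOn c₁ c₂ ψ θ₁ θ₂ U e₁ e₂ a₁ a₂ b₁ b₂) {q : M}
    (hq : q ∈ U) : IsTangentFrameAt c₁ c₂ ψ q (e₁ q) (e₂ q) := by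
  have q₁ := Real.sin_sq_add_cos_sq θ₁
  have q₂ := Real.sin_sq_add_cos_sq θ₂
  constructor <;> simp only [indMetric, prodMetric, h.push₁ q hq, h.push₂ q hq, form_smul_smul,
    h.form_a₁₁ q hq, h.form_a₂₂ q hq, h.form_a₁₂ q hq, h.form_b₁₁ q hq, h.form_b₂₂ q hq,
    h.form_b₁₂ q hq] <;> linarith

theorem form_table (h : IsAdaptedFrameOn c₁ c₂ ψ θ₁ θ₂ U e₁ e₂ a₁ a₂ b₁ b₂) {q : M} (hq : q ∈ U) :
    form c₁ (a₁ q) (a₁ q) = 1 ∧ form c₁ (a₂ q) (a₂ q) = 1 ∧ form c₁ (a₁ q) (a₂ q) = 0 ∧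
      form c₁ (a₂ q) (a₁ q) = 0 ∧ form c₂ (b₁ q) (b₁ q) = 1 ∧ form c₂ (b₂ q) (b₂ q) = 1 ∧
      form c₂ (b₁ q) (b₂ q) = 0 ∧ form c₂ (b₂ q) (b₁ q) = 0 :=
  ⟨h.form_a₁₁ q hq, h.form_a₂₂ q hq, h.form_a₁₂ q hq, h.form_a₂₁ hq, h.form_b₁₁ q hq,
    h.form_b₂₂ q hq, h.form_b₁₂ q hq, h.form_b₂₁ hq⟩

theorem isNormalVector₁ (h : IsAdaptedFrameOn c₁ c₂ ψ θ₁ θ₂ U e₁ e₂ a₁ a₂ b₁ b₂) {q : M}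
    (hq : q ∈ U) : IsNormalVector c₁ c₂ ψ q (adaptedNormal θ₁ a₁ b₁ q) := by
  refine ⟨isTangent_smul _ (h.tangent_a₁ q hq), isTangent_smul _ (h.tangent_b₁ q hq), fun v => ?_⟩
  rw [(h.isTangentFrameAt hq).eq_sum v, push_add, push_smul, push_smul, prodMetric_add_right,
    prodMetric_smul_right, prodMetric_smul_right, h.push₁ q hq, h.push₂ q hq]
  simp only [prodMetric, adaptedNormal, form_smul_smul, h.form_table hq]
  ring

theorem isNormalVector₂ (h : IsAdaptedFrameOn c₁ c₂ ψ θ₁ θ₂ U e₁ e₂ a₁ a₂ b₁ b₂) {q : M}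
    (hq : q ∈ U) : IsNormalVector c₁ c₂ ψ q (adaptedNormal θ₂ a₂ b₂ q) := by
  refine ⟨isTangent_smul _ (h.tangent_a₂ q hq), isTangent_smul _ (h.tangent_b₂ q hq), fun v => ?_⟩
  rw [(h.isTangentFrameAt hq).eq_sum v, push_add, push_smul, push_smul, prodMetric_add_right,
    prodMetric_smul_right, prodMetric_smul_right, h.push₁ q hq, h.push₂ q hq]
  simp only [prodMetric, adaptedNormal, form_smul_smul, h.form_table hq]
  ring

theorem isOrthonormalAt (h : IsAdaptedFrameOn c₁ c₂ ψ θ₁ θ₂ U e₁ e₂ a₁ a₂ b₁ b₂) {q : M}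
    (hq : q ∈ U) : IsOrthonormalAt c₁ c₂ ψ q (e₁ q) (e₂ q) (adaptedNormal θ₁ a₁ b₁ q)
      (adaptedNormal θ₂ a₂ b₂ q) := by
  have q₁ := Real.sin_sq_add_cos_sq θ₁
  have q₂ := Real.sin_sq_add_cos_sq θ₂
  have hf := h.isTangentFrameAt hq
  refine ⟨h.isNormalVector₁ hq, h.isNormalVector₂ hq, hf.metric₁₁, hf.metric₂₂, hf.metric₁₂,
    ?_, ?_, ?_⟩ <;>
  simp only [prodMetric, adaptedNormal, form_smul_smul, h.form_table hq]
  · linarith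
  · linarith
  · ring

/-- A vector tangent to `M²(c₁) × M²(c₂)` expanded in the adapted orthonormal basis. -/
theorem eq_sum (hψ : IsImmersedSurface c₁ c₂ ψ)
    (h : IsAdaptedFrameOn c₁ c₂ ψ θ₁ θ₂ U e₁ e₂ a₁ a₂ b₁ b₂) {q : M} (hq : q ∈ U) {w : V6}
    (hw₁ : IsTangent c₁ (ψ q).1 w.1) (hw₂ : IsTangent c₂ (ψ q).2 w.2) :
    w = prodMetric c₁ c₂ w (push ψ q (e₁ q)) • push ψ q (e₁ q) +
      prodMetric c₁ c₂ w (push ψ q (e₂ q)) • push ψ q (e₂ q) +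
      (prodMetric c₁ c₂ w (adaptedNormal θ₁ a₁ b₁ q) • adaptedNormal θ₁ a₁ b₁ q +
        prodMetric c₁ c₂ w (adaptedNormal θ₂ a₂ b₂ q) • adaptedNormal θ₂ a₂ b₂ q) := by
  have q₁ := Real.sin_sq_add_cos_sq θ₁
  have q₂ := Real.sin_sq_add_cos_sq θ₂
  have x₁ := tangentProj_eq_of_orthonormal (hψ.mem_fst q) (h.tangent_a₁ q hq) (h.tangent_a₂ q hq)
    (h.form_a₁₁ q hq) (h.form_a₂₂ q hq) (h.form_a₁₂ q hq) w.1
  have x₂ := tangentProj_eq_of_orthonormal (hψ.mem_snd q) (h.tangent_b₁ q hq) (h.tangent_b₂ q hq)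
    (h.form_b₁₁ q hq) (h.form_b₂₂ q hq) (h.form_b₁₂ q hq) w.2
  rw [tangentProj_of_isTangent (hψ.mem_fst q) hw₁] at x₁
  rw [tangentProj_of_isTangent (hψ.mem_snd q) hw₂] at x₂
  rw [h.push₁ q hq, h.push₂ q hq]
  simp only [prodMetric, adaptedNormal, form_smul_right]
  generalize form c₁ w.1 (a₁ q) = s₁ at *
  generalize form c₁ w.1 (a₂ q) = s₂ at *
  generalize form c₂ w.2 (b₁ q) = t₁ at *
  generalize form c₂ w.2 (b₂ q) = t₂ at *
  refine Prod.ext (x₁.trans ?_) (x₂.trans ?_)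
  · simp only [Prod.fst_add, Prod.smul_fst]
    linear_combination (norm := module) (-s₁ * q₁) • a₁ q + (-s₂ * q₂) • a₂ q
  · simp only [Prod.snd_add, Prod.smul_snd]
    linear_combination (norm := module) (-t₁ * q₁) • b₁ q + (-t₂ * q₂) • b₂ q

theorem norPart_eq (hψ : IsImmersedSurface c₁ c₂ ψ)
    (h : IsAdaptedFrameOn c₁ c₂ ψ θ₁ θ₂ U e₁ e₂ a₁ a₂ b₁ b₂) {q : M} (hq : q ∈ U) {w : V6}
    (hw₁ : IsTangent c₁ (ψ q).1 w.1) (hw₂ : IsTangent c₂ (ψ q).2 w.2) :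
    norPart c₁ c₂ ψ q w =
      prodMetric c₁ c₂ w (adaptedNormal θ₁ a₁ b₁ q) • adaptedNormal θ₁ a₁ b₁ q +
        prodMetric c₁ c₂ w (adaptedNormal θ₂ a₂ b₂ q) • adaptedNormal θ₂ a₂ b₂ q := by
  rw [norPart, (h.isTangentFrameAt hq).tanPart_eq, push_add, push_smul, push_smul,
    sub_eq_iff_eq_add']
  exact h.eq_sum hψ hq hw₁ hw₂

theorem eq_sum_of_isNormalVector (hψ : IsImmersedSurface c₁ c₂ ψ)
    (h : IsAdaptedFrameOn c₁ c₂ ψ θ₁ θ₂ U e₁ e₂ a₁ a₂ b₁ b₂) {q : M} (hq : q ∈ U) {ξ : V6}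
    (hξ : IsNormalVector c₁ c₂ ψ q ξ) :
    ξ = prodMetric c₁ c₂ ξ (adaptedNormal θ₁ a₁ b₁ q) • adaptedNormal θ₁ a₁ b₁ q +
        prodMetric c₁ c₂ ξ (adaptedNormal θ₂ a₂ b₂ q) • adaptedNormal θ₂ a₂ b₂ q := by
  have h1 := h.eq_sum hψ hq hξ.1 hξ.2.1
  rwa [hξ.2.2, hξ.2.2, zero_smul, zero_smul, zero_add, zero_add] at h1

/-- The right-hand side is the flat derivative projected to the normal frame, the form in which the
curvature is computed later. -/
theorem normalConn_eq (hψ : IsImmersedSurface c₁ c₂ ψ)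
    (h : IsAdaptedFrameOn c₁ c₂ ψ θ₁ θ₂ U e₁ e₂ a₁ a₂ b₁ b₂) {q : M} (hq : q ∈ U) (ξ : M → V6)
    (v : TangentSpace (𝓡 2) q) :
    normalConn c₁ c₂ ψ ξ q v =
      prodMetric c₁ c₂ (mvfderiv (𝓡 2) ξ q v) (adaptedNormal θ₁ a₁ b₁ q) •
          adaptedNormal θ₁ a₁ b₁ q +
        prodMetric c₁ c₂ (mvfderiv (𝓡 2) ξ q v) (adaptedNormal θ₂ a₂ b₂ q) •
          adaptedNormal θ₂ a₂ b₂ q := by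
  have n₁ := h.isNormalVector₁ hq
  have n₂ := h.isNormalVector₂ hq
  rw [normalConn, h.norPart_eq hψ hq (isTangent_ambientConn_fst hψ _ _ _)
    (isTangent_ambientConn_snd hψ _ _ _), prodMetric_ambientConn hψ _ _ _ n₁.1 n₁.2.1,
    prodMetric_ambientConn hψ _ _ _ n₂.1 n₂.2.1]

theorem shape_eq (hψ : IsImmersedSurface c₁ c₂ ψ)
    (h : IsAdaptedFrameOn c₁ c₂ ψ θ₁ θ₂ U e₁ e₂ a₁ a₂ b₁ b₂) {q : M} (hq : q ∈ U) (ξ : M → V6)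
    (v : TangentSpace (𝓡 2) q) :
    shape c₁ c₂ ψ ξ q v =
      -(prodMetric c₁ c₂ (mvfderiv (𝓡 2) ξ q v) (push ψ q (e₁ q)) • e₁ q +
        prodMetric c₁ c₂ (mvfderiv (𝓡 2) ξ q v) (push ψ q (e₂ q)) • e₂ q) := by
  rw [shape, (h.isTangentFrameAt hq).tanPart_eq,
    prodMetric_ambientConn hψ _ _ _ (isTangent_push_fst hψ _) (isTangent_push_snd hψ _),
    prodMetric_ambientConn hψ _ _ _ (isTangent_push_fst hψ _) (isTangent_push_snd hψ _)]

theorem fTensor_e₁ (h : IsAdaptedFrameOn c₁ c₂ ψ θ₁ θ₂ U e₁ e₂ a₁ a₂ b₁ b₂) {q : M} (hq : q ∈ U) :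
    fTensor c₁ c₂ ψ q (e₁ q) = Real.cos (2 * θ₁) • e₁ q := by
  rw [fTensor, (h.isTangentFrameAt hq).tanPart_eq, prodMetric_prodStructure,
    prodMetric_prodStructure, h.push₁ q hq, h.push₂ q hq]
  simp only [form_smul_smul, h.form_table hq]
  rw [Real.cos_two_mul']
  module

theorem fTensor_e₂ (h : IsAdaptedFrameOn c₁ c₂ ψ θ₁ θ₂ U e₁ e₂ a₁ a₂ b₁ b₂) {q : M} (hq : q ∈ U) :
    fTensor c₁ c₂ ψ q (e₂ q) = Real.cos (2 * θ₂) • e₂ q := by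
  rw [fTensor, (h.isTangentFrameAt hq).tanPart_eq, prodMetric_prodStructure,
    prodMetric_prodStructure, h.push₁ q hq, h.push₂ q hq]
  simp only [form_smul_smul, h.form_table hq]
  rw [Real.cos_two_mul']
  module

theorem tTensor_eq (hψ : IsImmersedSurface c₁ c₂ ψ)
    (h : IsAdaptedFrameOn c₁ c₂ ψ θ₁ θ₂ U e₁ e₂ a₁ a₂ b₁ b₂) {q : M} (hq : q ∈ U) {ξ : V6}
    (hξ : IsNormalVector c₁ c₂ ψ q ξ) :
    tTensor c₁ c₂ ψ q ξ =
      (form c₁ ξ.1 (Real.sin θ₁ • a₁ q) - form c₂ ξ.2 (-Real.cos θ₁ • b₁ q)) •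
          adaptedNormal θ₁ a₁ b₁ q +
        (form c₁ ξ.1 (Real.sin θ₂ • a₂ q) - form c₂ ξ.2 (-Real.cos θ₂ • b₂ q)) •
          adaptedNormal θ₂ a₂ b₂ q := by
  have ht : IsTangent c₂ (ψ q).2 (-ξ.2) := by
    rw [← neg_one_smul ℝ]; exact isTangent_smul _ hξ.2.1
  rw [tTensor, h.norPart_eq hψ hq (w := prodStructure ξ) hξ.1 ht, prodMetric_prodStructure,
    prodMetric_prodStructure]
  rfl

theorem tTensor_adaptedNormal₁ (hψ : IsImmersedSurface c₁ c₂ ψ)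
    (h : IsAdaptedFrameOn c₁ c₂ ψ θ₁ θ₂ U e₁ e₂ a₁ a₂ b₁ b₂) {q : M} (hq : q ∈ U) :
    tTensor c₁ c₂ ψ q (adaptedNormal θ₁ a₁ b₁ q) =
      -Real.cos (2 * θ₁) • adaptedNormal θ₁ a₁ b₁ q := by
  rw [h.tTensor_eq hψ hq (h.isNormalVector₁ hq)]
  conv_lhs => simp only [adaptedNormal, form_smul_smul, h.form_table hq]
  rw [Real.cos_two_mul']
  simp only [adaptedNormal]
  module

theorem tTensor_adaptedNormal₂ (hψ : IsImmersedSurface c₁ c₂ ψ)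
    (h : IsAdaptedFrameOn c₁ c₂ ψ θ₁ θ₂ U e₁ e₂ a₁ a₂ b₁ b₂) {q : M} (hq : q ∈ U) :
    tTensor c₁ c₂ ψ q (adaptedNormal θ₂ a₂ b₂ q) =
      -Real.cos (2 * θ₂) • adaptedNormal θ₂ a₂ b₂ q := by
  rw [h.tTensor_eq hψ hq (h.isNormalVector₂ hq)]
  conv_lhs => simp only [adaptedNormal, form_smul_smul, h.form_table hq]
  rw [Real.cos_two_mul']
  simp only [adaptedNormal]
  module

end IsAdaptedFrameOn

end Surface
end ProductSurface

namespace ProductSurface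

section Surface

variable {M : Type*} [TopologicalSpace M] [ChartedSpace (EuclideanSpace ℝ (Fin 2)) M]
  {c₁ c₂ : ℝ} {ψ : M → V6}

/-- The connection form of the frame `a₁, a₂`. -/
def connForm (c : ℝ) (a₁ a₂ : M → V3) (q : M) (v : TangentSpace (𝓡 2) q) : ℝ :=
  form c (mvfderiv (𝓡 2) a₁ q v) (a₂ q)

/-- The tangent components of the derivatives of an orthonormal frame. -/
theorem form_mvfderiv_frame {c : ℝ} {a₁ a₂ : M → V3} (hU : IsOpen U) {q : M} (hq : q ∈ U)
    (ha₁ : MDifferentiableAt (𝓡 2) 𝓘(ℝ, V3) a₁ q) (ha₂ : MDifferentiableAt (𝓡 2) 𝓘(ℝ, V3) a₂ q)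
    (h₁ : ∀ q ∈ U, form c (a₁ q) (a₁ q) = 1) (h₂ : ∀ q ∈ U, form c (a₂ q) (a₂ q) = 1)
    (h₁₂ : ∀ q ∈ U, form c (a₁ q) (a₂ q) = 0) (v : TangentSpace (𝓡 2) q) :
    form c (mvfderiv (𝓡 2) a₁ q v) (a₁ q) = 0 ∧ form c (mvfderiv (𝓡 2) a₂ q v) (a₂ q) = 0 ∧
      form c (mvfderiv (𝓡 2) a₁ q v) (a₂ q) = connForm c a₁ a₂ q v ∧
      form c (mvfderiv (𝓡 2) a₂ q v) (a₁ q) = -connForm c a₁ a₂ q v := by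
  have hn := hU.mem_nhds hq
  have k₁ := form_mvfderiv_add_eq_zero ha₁ ha₁ (Filter.eventually_of_mem hn h₁) v
  have k₂ := form_mvfderiv_add_eq_zero ha₂ ha₂ (Filter.eventually_of_mem hn h₂) v
  have k₁₂ := form_mvfderiv_add_eq_zero ha₁ ha₂ (Filter.eventually_of_mem hn h₁₂) v
  rw [form_comm c (a₁ q)] at k₁ k₁₂
  rw [form_comm c (a₂ q)] at k₂
  refine ⟨by linarith, by linarith, rfl, ?_⟩
  simp only [connForm]
  linarith

variable [IsManifold (𝓡 2) ∞ M]

namespace IsAdaptedFrameOn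

variable {θ₁ θ₂ : ℝ} {U : Set M} {e₁ e₂ : (q : M) → TangentSpace (𝓡 2) q} {a₁ a₂ b₁ b₂ : M → V3}

/-! ### The connection forms of an adapted frame -/

theorem mdifferentiableAt (h : IsAdaptedFrameOn c₁ c₂ ψ θ₁ θ₂ U e₁ e₂ a₁ a₂ b₁ b₂) {q : M}
    (hq : q ∈ U) :
    MDifferentiableAt (𝓡 2) 𝓘(ℝ, V3) a₁ q ∧ MDifferentiableAt (𝓡 2) 𝓘(ℝ, V3) a₂ q ∧
      MDifferentiableAt (𝓡 2) 𝓘(ℝ, V3) b₁ q ∧ MDifferentiableAt (𝓡 2) 𝓘(ℝ, V3) b₂ q := by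
  have hU := h.isOpen.mem_nhds hq
  exact ⟨(h.smooth_a₁.contMDiffAt hU).mdifferentiableAt (by simp),
    (h.smooth_a₂.contMDiffAt hU).mdifferentiableAt (by simp),
    (h.smooth_b₁.contMDiffAt hU).mdifferentiableAt (by simp),
    (h.smooth_b₂.contMDiffAt hU).mdifferentiableAt (by simp)⟩

theorem form_mvfderiv_table (h : IsAdaptedFrameOn c₁ c₂ ψ θ₁ θ₂ U e₁ e₂ a₁ a₂ b₁ b₂) {q : M}
    (hq : q ∈ U) (v : TangentSpace (𝓡 2) q) :
    (form c₁ (mvfderiv (𝓡 2) a₁ q v) (a₁ q) = 0 ∧ form c₁ (mvfderiv (𝓡 2) a₂ q v) (a₂ q) = 0 ∧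
      form c₁ (mvfderiv (𝓡 2) a₁ q v) (a₂ q) = connForm c₁ a₁ a₂ q v ∧
      form c₁ (mvfderiv (𝓡 2) a₂ q v) (a₁ q) = -connForm c₁ a₁ a₂ q v) ∧
    (form c₂ (mvfderiv (𝓡 2) b₁ q v) (b₁ q) = 0 ∧ form c₂ (mvfderiv (𝓡 2) b₂ q v) (b₂ q) = 0 ∧
      form c₂ (mvfderiv (𝓡 2) b₁ q v) (b₂ q) = connForm c₂ b₁ b₂ q v ∧
      form c₂ (mvfderiv (𝓡 2) b₂ q v) (b₁ q) = -connForm c₂ b₁ b₂ q v) := by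
  obtain ⟨da₁, da₂, db₁, db₂⟩ := h.mdifferentiableAt hq
  exact ⟨form_mvfderiv_frame h.isOpen hq da₁ da₂ h.form_a₁₁ h.form_a₂₂ h.form_a₁₂ v,
    form_mvfderiv_frame h.isOpen hq db₁ db₂ h.form_b₁₁ h.form_b₂₂ h.form_b₁₂ v⟩

theorem mvfderiv_push₁ (h : IsAdaptedFrameOn c₁ c₂ ψ θ₁ θ₂ U e₁ e₂ a₁ a₂ b₁ b₂) {q : M}
    (hq : q ∈ U) (v : TangentSpace (𝓡 2) q) :
    mvfderiv (𝓡 2) (fun q => push ψ q (e₁ q)) q v =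
      (Real.cos θ₁ • mvfderiv (𝓡 2) a₁ q v, Real.sin θ₁ • mvfderiv (𝓡 2) b₁ q v) := by
  obtain ⟨da₁, da₂, db₁, db₂⟩ := h.mdifferentiableAt hq
  have he : (fun q => push ψ q (e₁ q)) =ᶠ[𝓝 q] fun q => (Real.cos θ₁ • a₁ q, Real.sin θ₁ • b₁ q) :=
    Filter.eventually_of_mem (h.isOpen.mem_nhds hq) h.push₁
  rw [he.mvfderiv_eq, mvfderiv_prod_smul da₁ db₁]

theorem mvfderiv_push₂ (h : IsAdaptedFrameOn c₁ c₂ ψ θ₁ θ₂ U e₁ e₂ a₁ a₂ b₁ b₂) {q : M}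
    (hq : q ∈ U) (v : TangentSpace (𝓡 2) q) :
    mvfderiv (𝓡 2) (fun q => push ψ q (e₂ q)) q v =
      (Real.cos θ₂ • mvfderiv (𝓡 2) a₂ q v, Real.sin θ₂ • mvfderiv (𝓡 2) b₂ q v) := by
  obtain ⟨da₁, da₂, db₁, db₂⟩ := h.mdifferentiableAt hq
  have he : (fun q => push ψ q (e₂ q)) =ᶠ[𝓝 q] fun q => (Real.cos θ₂ • a₂ q, Real.sin θ₂ • b₂ q) :=
    Filter.eventually_of_mem (h.isOpen.mem_nhds hq) h.push₂
  rw [he.mvfderiv_eq, mvfderiv_prod_smul da₂ db₂]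

theorem mvfderiv_adaptedNormal₁ (h : IsAdaptedFrameOn c₁ c₂ ψ θ₁ θ₂ U e₁ e₂ a₁ a₂ b₁ b₂) {q : M}
    (hq : q ∈ U) (v : TangentSpace (𝓡 2) q) :
    mvfderiv (𝓡 2) (adaptedNormal θ₁ a₁ b₁) q v =
      (Real.sin θ₁ • mvfderiv (𝓡 2) a₁ q v, -Real.cos θ₁ • mvfderiv (𝓡 2) b₁ q v) :=
  mvfderiv_prod_smul (h.mdifferentiableAt hq).1 (h.mdifferentiableAt hq).2.2.1 _ _ v

theorem mvfderiv_adaptedNormal₂ (h : IsAdaptedFrameOn c₁ c₂ ψ θ₁ θ₂ U e₁ e₂ a₁ a₂ b₁ b₂) {q : M}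
    (hq : q ∈ U) (v : TangentSpace (𝓡 2) q) :
    mvfderiv (𝓡 2) (adaptedNormal θ₂ a₂ b₂) q v =
      (Real.sin θ₂ • mvfderiv (𝓡 2) a₂ q v, -Real.cos θ₂ • mvfderiv (𝓡 2) b₂ q v) :=
  mvfderiv_prod_smul (h.mdifferentiableAt hq).2.1 (h.mdifferentiableAt hq).2.2.2 _ _ v

/-- The two derivatives differ by `dψ [e₁, e₂]`, which is orthogonal to `ξ`. -/
theorem prodMetric_mvfderiv_symm (hψ : IsImmersedSurface c₁ c₂ ψ)
    (h : IsAdaptedFrameOn c₁ c₂ ψ θ₁ θ₂ U e₁ e₂ a₁ a₂ b₁ b₂) {q : M} (hq : q ∈ U) {ξ : V6}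
    (hξ : IsNormalVector c₁ c₂ ψ q ξ) :
    prodMetric c₁ c₂ (mvfderiv (𝓡 2) (fun q => push ψ q (e₂ q)) q (e₁ q)) ξ =
      prodMetric c₁ c₂ (mvfderiv (𝓡 2) (fun q => push ψ q (e₁ q)) q (e₂ q)) ξ := by
  have h1 := push_mlieBracket hψ (h.field₁.diffFieldAt h.isOpen hq)
    (h.field₂.diffFieldAt h.isOpen hq)
  have h2 := hξ.2.2 (VectorField.mlieBracket (𝓡 2) e₁ e₂ q)
  rw [prodMetric_comm, h1, prodMetric_sub_left] at h2
  linarith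

/-- The symmetry of the second fundamental form, expressed by the connection forms. -/
theorem connForm_symm (hψ : IsImmersedSurface c₁ c₂ ψ)
    (h : IsAdaptedFrameOn c₁ c₂ ψ θ₁ θ₂ U e₁ e₂ a₁ a₂ b₁ b₂) {q : M} (hq : q ∈ U) :
    Real.cos θ₂ * Real.sin θ₁ * connForm c₁ a₁ a₂ q (e₁ q) =
        Real.sin θ₂ * Real.cos θ₁ * connForm c₂ b₁ b₂ q (e₁ q) ∧
      Real.cos θ₁ * Real.sin θ₂ * connForm c₁ a₁ a₂ q (e₂ q) =
        Real.sin θ₁ * Real.cos θ₂ * connForm c₂ b₁ b₂ q (e₂ q) := by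
  have s₁ := h.prodMetric_mvfderiv_symm hψ hq (h.isNormalVector₁ hq)
  have s₂ := h.prodMetric_mvfderiv_symm hψ hq (h.isNormalVector₂ hq)
  rw [h.mvfderiv_push₁ hq, h.mvfderiv_push₂ hq] at s₁ s₂
  -- Because `aᵢ` and `bᵢ` have unit length, `⟨D eᵢ, ξᵢ⟩ = 0`; so one side of each symmetry relation
  -- vanishes.
  simp only [prodMetric, adaptedNormal, form_smul_smul, h.form_mvfderiv_table hq] at s₁ s₂
  constructor <;> linarith

theorem connForm_eq_sum (h : IsAdaptedFrameOn c₁ c₂ ψ θ₁ θ₂ U e₁ e₂ a₁ a₂ b₁ b₂) {q : M}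
    (hq : q ∈ U) (c : ℝ) (f₁ f₂ : M → V3) (v : TangentSpace (𝓡 2) q) :
    connForm c f₁ f₂ q v = indMetric c₁ c₂ ψ q v (e₁ q) * connForm c f₁ f₂ q (e₁ q) +
      indMetric c₁ c₂ ψ q v (e₂ q) * connForm c f₁ f₂ q (e₂ q) := by
  conv_lhs => rw [(h.isTangentFrameAt hq).eq_sum v]
  simp only [connForm, map_add, map_smul, form_add_left, form_smul_left]

theorem smooth_connForm (h : IsAdaptedFrameOn c₁ c₂ ψ θ₁ θ₂ U e₁ e₂ a₁ a₂ b₁ b₂) (c : ℝ)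
    {f₁ f₂ : M → V3} (hf₁ : ContMDiffOn (𝓡 2) 𝓘(ℝ, V3) ∞ f₁ U)
    (hf₂ : ContMDiffOn (𝓡 2) 𝓘(ℝ, V3) ∞ f₂ U) {X : (q : M) → TangentSpace (𝓡 2) q}
    (hX : IsTangentField X U) :
    ContMDiffOn (𝓡 2) 𝓘(ℝ, ℝ) ∞ (fun q => connForm c f₁ f₂ q (X q)) U :=
  (hf₁.mvfderiv_apply h.isOpen hX (by simp)).bilinear_apply (formL c) hf₂

theorem isNormalField₁ (h : IsAdaptedFrameOn c₁ c₂ ψ θ₁ θ₂ U e₁ e₂ a₁ a₂ b₁ b₂) :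
    IsNormalField c₁ c₂ ψ (adaptedNormal θ₁ a₁ b₁) U :=
  ⟨((Real.sin θ₁ • ContinuousLinearMap.fst ℝ V3 V3).prod
      (-Real.cos θ₁ • ContinuousLinearMap.snd ℝ V3 V3)).contMDiff.comp_contMDiffOn
        (h.smooth_a₁.prodMk_space h.smooth_b₁),
    fun _ hq => h.isNormalVector₁ hq⟩

theorem isNormalField₂ (h : IsAdaptedFrameOn c₁ c₂ ψ θ₁ θ₂ U e₁ e₂ a₁ a₂ b₁ b₂) :
    IsNormalField c₁ c₂ ψ (adaptedNormal θ₂ a₂ b₂) U :=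
  ⟨((Real.sin θ₂ • ContinuousLinearMap.fst ℝ V3 V3).prod
      (-Real.cos θ₂ • ContinuousLinearMap.snd ℝ V3 V3)).contMDiff.comp_contMDiffOn
        (h.smooth_a₂.prodMk_space h.smooth_b₂),
    fun _ hq => h.isNormalVector₂ hq⟩

/-- The principal curvature function of `ξ₁` in the direction `e₂`. -/
def mu₁ (c₁ c₂ θ₁ θ₂ : ℝ) (e₂ : (q : M) → TangentSpace (𝓡 2) q) (a₁ a₂ b₁ b₂ : M → V3) (q : M) :
    ℝ :=
  Real.sin θ₂ * Real.cos θ₁ * connForm c₂ b₁ b₂ q (e₂ q) -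
    Real.cos θ₂ * Real.sin θ₁ * connForm c₁ a₁ a₂ q (e₂ q)

/-- The principal curvature function of `ξ₂` in the direction `e₁`. -/
def mu₂ (c₁ c₂ θ₁ θ₂ : ℝ) (e₁ : (q : M) → TangentSpace (𝓡 2) q) (a₁ a₂ b₁ b₂ : M → V3) (q : M) :
    ℝ :=
  Real.cos θ₁ * Real.sin θ₂ * connForm c₁ a₁ a₂ q (e₁ q) -
    Real.sin θ₁ * Real.cos θ₂ * connForm c₂ b₁ b₂ q (e₁ q)

/-- The `eᵢ`-component of the shape operator of `ξᵢ` vanishes by unit length of `aᵢ` and `bᵢ`. The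
other component is a combination of `α` and `β`, zero on `eᵢ` by `connForm_symm`; its value on the
other frame vector is the definition of `mu₁` or `mu₂`. -/
theorem shape_adaptedNormal (hψ : IsImmersedSurface c₁ c₂ ψ)
    (h : IsAdaptedFrameOn c₁ c₂ ψ θ₁ θ₂ U e₁ e₂ a₁ a₂ b₁ b₂) {q : M} (hq : q ∈ U) :
    shape c₁ c₂ ψ (adaptedNormal θ₁ a₁ b₁) q (e₁ q) = 0 ∧
      shape c₁ c₂ ψ (adaptedNormal θ₁ a₁ b₁) q (e₂ q) =
        mu₁ c₁ c₂ θ₁ θ₂ e₂ a₁ a₂ b₁ b₂ q • e₂ q ∧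
      shape c₁ c₂ ψ (adaptedNormal θ₂ a₂ b₂) q (e₁ q) =
        mu₂ c₁ c₂ θ₁ θ₂ e₁ a₁ a₂ b₁ b₂ q • e₁ q ∧
      shape c₁ c₂ ψ (adaptedNormal θ₂ a₂ b₂) q (e₂ q) = 0 := by
  obtain ⟨r₁, r₂⟩ := h.connForm_symm hψ hq
  refine ⟨?_, ?_, ?_, ?_⟩ <;>
    simp only [h.shape_eq hψ hq, h.mvfderiv_adaptedNormal₁ hq, h.mvfderiv_adaptedNormal₂ hq,
      h.push₁ q hq, h.push₂ q hq, prodMetric, form_smul_smul, h.form_mvfderiv_table hq, mu₁, mu₂]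
  · linear_combination (norm := module) -r₁ • e₂ q
  · module
  · module
  · linear_combination (norm := module) r₂ • e₁ q

/-- The left-hand side is `cos θ₁ cos θ₂ α + sin θ₁ sin θ₂ β`. On each `eᵢ`, `connForm_symm` and the
definition of `mu₁` or `mu₂` are two linear equations for `α` and `β`. -/
theorem indMetric_leviCivita (hψ : IsImmersedSurface c₁ c₂ ψ)
    (h : IsAdaptedFrameOn c₁ c₂ ψ θ₁ θ₂ U e₁ e₂ a₁ a₂ b₁ b₂)
    (hθ : Real.cos θ₁ ^ 2 - Real.cos θ₂ ^ 2 ≠ 0) {q : M} (hq : q ∈ U)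
    (v : TangentSpace (𝓡 2) q) :
    indMetric c₁ c₂ ψ q (leviCivita c₁ c₂ ψ e₁ q v) (e₂ q) =
      (Real.cos θ₁ * Real.sin θ₁ * mu₁ c₁ c₂ θ₁ θ₂ e₂ a₁ a₂ b₁ b₂ q *
          indMetric c₁ c₂ ψ q v (e₂ q) +
        Real.cos θ₂ * Real.sin θ₂ * mu₂ c₁ c₂ θ₁ θ₂ e₁ a₁ a₂ b₁ b₂ q *
          indMetric c₁ c₂ ψ q v (e₁ q)) / (Real.cos θ₁ ^ 2 - Real.cos θ₂ ^ 2) := by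
  obtain ⟨r₁, r₂⟩ := h.connForm_symm hψ hq
  have q₁ := Real.sin_sq_add_cos_sq θ₁
  have q₂ := Real.sin_sq_add_cos_sq θ₂
  have hf := h.isTangentFrameAt hq
  rw [leviCivita_eq_tanPart hψ hf (h.field₁.diffFieldAt h.isOpen hq), hf.indMetric_tanPart,
    h.mvfderiv_push₁ hq, h.push₂ q hq, eq_div_iff hθ]
  simp only [prodMetric, form_smul_smul, h.form_mvfderiv_table hq, mu₁, mu₂]
  rw [h.connForm_eq_sum hq c₁, h.connForm_eq_sum hq c₂]
  generalize indMetric c₁ c₂ ψ q v (e₁ q) = x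
  generalize indMetric c₁ c₂ ψ q v (e₂ q) = y
  generalize connForm c₁ a₁ a₂ q (e₁ q) = α₁ at *
  generalize connForm c₁ a₁ a₂ q (e₂ q) = α₂ at *
  generalize connForm c₂ b₁ b₂ q (e₁ q) = β₁ at *
  generalize connForm c₂ b₁ b₂ q (e₂ q) = β₂ at *
  -- `q₁ - q₂` trades `cos² θ₁ - cos² θ₂` for `sin² θ₂ - sin² θ₁` in the `α` terms.
  linear_combination (-x * Real.cos θ₁ * Real.sin θ₁) * r₁ + y * Real.cos θ₂ * Real.sin θ₂ * r₂ +
    (x * α₁ + y * α₂) * Real.cos θ₁ * Real.cos θ₂ * (q₁ - q₂)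

/-- Here the left-hand side is `sin θ₁ sin θ₂ α + cos θ₁ cos θ₂ β`, and the same relations eliminate
`α` and `β`. -/
theorem prodMetric_normalConn (hψ : IsImmersedSurface c₁ c₂ ψ)
    (h : IsAdaptedFrameOn c₁ c₂ ψ θ₁ θ₂ U e₁ e₂ a₁ a₂ b₁ b₂)
    (hθ : Real.cos θ₁ ^ 2 - Real.cos θ₂ ^ 2 ≠ 0) {q : M} (hq : q ∈ U)
    (v : TangentSpace (𝓡 2) q) :
    prodMetric c₁ c₂ (normalConn c₁ c₂ ψ (adaptedNormal θ₁ a₁ b₁) q v) (adaptedNormal θ₂ a₂ b₂ q) =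
      (Real.cos θ₁ * Real.sin θ₁ * mu₂ c₁ c₂ θ₁ θ₂ e₁ a₁ a₂ b₁ b₂ q *
          indMetric c₁ c₂ ψ q v (e₁ q) +
        Real.cos θ₂ * Real.sin θ₂ * mu₁ c₁ c₂ θ₁ θ₂ e₂ a₁ a₂ b₁ b₂ q *
          indMetric c₁ c₂ ψ q v (e₂ q)) / (Real.cos θ₁ ^ 2 - Real.cos θ₂ ^ 2) := by
  obtain ⟨r₁, r₂⟩ := h.connForm_symm hψ hq
  have q₁ := Real.sin_sq_add_cos_sq θ₁
  have q₂ := Real.sin_sq_add_cos_sq θ₂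
  have ho := h.isOrthonormalAt hq
  rw [h.normalConn_eq hψ hq, prodMetric_add_left, prodMetric_smul_left, prodMetric_smul_left,
    ho.normal₁₂, ho.normal₂₂, h.mvfderiv_adaptedNormal₁ hq, eq_div_iff hθ]
  simp only [prodMetric, adaptedNormal, form_smul_smul, h.form_mvfderiv_table hq, mu₁, mu₂]
  rw [h.connForm_eq_sum hq c₁, h.connForm_eq_sum hq c₂]
  generalize indMetric c₁ c₂ ψ q v (e₁ q) = x
  generalize indMetric c₁ c₂ ψ q v (e₂ q) = y
  generalize connForm c₁ a₁ a₂ q (e₁ q) = α₁ at *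
  generalize connForm c₁ a₁ a₂ q (e₂ q) = α₂ at *
  generalize connForm c₂ b₁ b₂ q (e₁ q) = β₁ at *
  generalize connForm c₂ b₁ b₂ q (e₂ q) = β₂ at *
  linear_combination (-x * Real.cos θ₂ * Real.sin θ₂) * r₁ + y * Real.cos θ₁ * Real.sin θ₁ * r₂ +
    (x * β₁ + y * β₂) * Real.cos θ₁ * Real.cos θ₂ * (q₁ - q₂)

end IsAdaptedFrameOn

end Surface
end ProductSurface

namespace ProductSurface

section Surface

variable {M : Type*} [TopologicalSpace M] [ChartedSpace (EuclideanSpace ℝ (Fin 2)) M]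
  {c₁ c₂ : ℝ} {ψ : M → V6}

/-! ### The curvature of the connection projected to a plane field -/

/-- `E₁, E₂` are smooth orthonormal fields on `U` with values in the ambient vector space. -/
structure IsOrthonormalFieldsOn (c₁ c₂ : ℝ) (U : Set M) (E₁ E₂ : M → V6) : Prop where
  isOpen : IsOpen U
  smooth₁ : ContMDiffOn (𝓡 2) 𝓘(ℝ, V6) ∞ E₁ U
  smooth₂ : ContMDiffOn (𝓡 2) 𝓘(ℝ, V6) ∞ E₂ U
  metric₁₁ : ∀ q ∈ U, prodMetric c₁ c₂ (E₁ q) (E₁ q) = 1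
  metric₂₂ : ∀ q ∈ U, prodMetric c₁ c₂ (E₂ q) (E₂ q) = 1
  metric₁₂ : ∀ q ∈ U, prodMetric c₁ c₂ (E₁ q) (E₂ q) = 0

theorem IsOrthonormalFieldsOn.symm {U : Set M} {E₁ E₂ : M → V6}
    (h : IsOrthonormalFieldsOn c₁ c₂ U E₁ E₂) : IsOrthonormalFieldsOn c₁ c₂ U E₂ E₁ :=
  ⟨h.isOpen, h.smooth₂, h.smooth₁, h.metric₂₂, h.metric₁₁,
    fun q hq => by rw [prodMetric_comm, h.metric₁₂ q hq]⟩

theorem IsOrthonormalFieldsOn.mono {U V : Set M} {E₁ E₂ : M → V6}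
    (h : IsOrthonormalFieldsOn c₁ c₂ U E₁ E₂) (hV : IsOpen V) (hVU : V ⊆ U) :
    IsOrthonormalFieldsOn c₁ c₂ V E₁ E₂ :=
  ⟨hV, h.smooth₁.mono hVU, h.smooth₂.mono hVU, fun q hq => h.metric₁₁ q (hVU hq),
    fun q hq => h.metric₂₂ q (hVU hq), fun q hq => h.metric₁₂ q (hVU hq)⟩

/-- The orthogonal projection of the flat derivative of `ζ` onto the plane spanned by `E₁, E₂`. -/
def projConn (c₁ c₂ : ℝ) (E₁ E₂ ζ : M → V6) (q : M) (v : TangentSpace (𝓡 2) q) : V6 :=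
  prodMetric c₁ c₂ (mvfderiv (𝓡 2) ζ q v) (E₁ q) • E₁ q +
    prodMetric c₁ c₂ (mvfderiv (𝓡 2) ζ q v) (E₂ q) • E₂ q

theorem projConn_swap (E₁ E₂ ζ : M → V6) : projConn c₁ c₂ E₁ E₂ ζ = projConn c₁ c₂ E₂ E₁ ζ := by
  funext q v
  exact add_comm _ _

theorem mvfderiv_smul_field {f : M → ℝ} {u : M → V6} {p : M}
    (hf : MDifferentiableAt (𝓡 2) 𝓘(ℝ, ℝ) f p) (hu : MDifferentiableAt (𝓡 2) 𝓘(ℝ, V6) u p)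
    (v : TangentSpace (𝓡 2) p) :
    mvfderiv (𝓡 2) (fun q => f q • u q) p v =
      mvfderiv (𝓡 2) f p v • u p + f p • mvfderiv (𝓡 2) u p v :=
  mvfderiv_bilinear_apply (ContinuousLinearMap.lsmul ℝ ℝ) hf hu v

theorem prodMetric_mvfderiv_add_eq_zero {u v : M → V6} {r : ℝ} {U : Set M} (hU : IsOpen U) {p : M}
    (hp : p ∈ U) (hu : MDifferentiableAt (𝓡 2) 𝓘(ℝ, V6) u p)
    (hv : MDifferentiableAt (𝓡 2) 𝓘(ℝ, V6) v p) (h : ∀ q ∈ U, prodMetric c₁ c₂ (u q) (v q) = r)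
    (w : TangentSpace (𝓡 2) p) :
    prodMetric c₁ c₂ (mvfderiv (𝓡 2) u p w) (v p) +
      prodMetric c₁ c₂ (u p) (mvfderiv (𝓡 2) v p w) = 0 := by
  rw [← mvfderiv_prodMetric hu hv]
  have h1 : (fun q => prodMetric c₁ c₂ (u q) (v q)) =ᶠ[𝓝 p] fun _ => r :=
    Filter.eventually_of_mem (hU.mem_nhds hp) h
  rw [h1.mvfderiv_eq, mvfderiv_const]
  rfl

variable [IsManifold (𝓡 2) ∞ M]

theorem mdifferentiableAt_projConn {U : Set M} {E₁ E₂ ζ : M → V6}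
    (h : IsOrthonormalFieldsOn c₁ c₂ U E₁ E₂) (hζ : ContMDiffOn (𝓡 2) 𝓘(ℝ, V6) ∞ ζ U) {p : M}
    (hp : p ∈ U) {Y : (q : M) → TangentSpace (𝓡 2) q} (hY : DiffFieldAt Y p) :
    MDifferentiableAt (𝓡 2) 𝓘(ℝ, V6) (fun q => projConn c₁ c₂ E₁ E₂ ζ q (Y q)) p := by
  have hU := h.isOpen.mem_nhds hp
  have d₁ := (h.smooth₁.contMDiffAt hU).mdifferentiableAt (by simp)
  have d₂ := (h.smooth₂.contMDiffAt hU).mdifferentiableAt (by simp)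
  have dY := hζ.mdifferentiableAt_mvfderiv_apply h.isOpen hp ENat.LEInfty.out hY
  exact (MDifferentiableAt.bilinear_apply (ContinuousLinearMap.lsmul ℝ ℝ)
    (dY.bilinear_apply (prodMetricL c₁ c₂) d₁) d₁).add
      (MDifferentiableAt.bilinear_apply (ContinuousLinearMap.lsmul ℝ ℝ)
        (dY.bilinear_apply (prodMetricL c₁ c₂) d₂) d₂)

/-- Differentiates `⟨projConn ζ, E₁⟩ = ⟨D ζ, E₁⟩`. Since `⟨E₁, D E₁⟩ = 0`, only the `E₂`-component
of the projection pairs with `D E₁`. -/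
theorem prodMetric_mvfderiv_projConn {U : Set M} {E₁ E₂ ζ : M → V6}
    (h : IsOrthonormalFieldsOn c₁ c₂ U E₁ E₂) (hζ : ContMDiffOn (𝓡 2) 𝓘(ℝ, V6) ∞ ζ U) {p : M}
    (hp : p ∈ U) {Y : (q : M) → TangentSpace (𝓡 2) q} (hY : DiffFieldAt Y p)
    (v : TangentSpace (𝓡 2) p) :
    prodMetric c₁ c₂ (mvfderiv (𝓡 2) (fun q => projConn c₁ c₂ E₁ E₂ ζ q (Y q)) p v) (E₁ p) =
      prodMetric c₁ c₂ (mvfderiv (𝓡 2) (fun q => mvfderiv (𝓡 2) ζ q (Y q)) p v) (E₁ p) +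
        prodMetric c₁ c₂ (mvfderiv (𝓡 2) ζ p (Y p)) (mvfderiv (𝓡 2) E₁ p v) -
        prodMetric c₁ c₂ (mvfderiv (𝓡 2) ζ p (Y p)) (E₂ p) *
          prodMetric c₁ c₂ (mvfderiv (𝓡 2) E₁ p v) (E₂ p) := by
  have hU := h.isOpen.mem_nhds hp
  have d₁ := (h.smooth₁.contMDiffAt hU).mdifferentiableAt (by simp)
  have dY := hζ.mdifferentiableAt_mvfderiv_apply h.isOpen hp ENat.LEInfty.out hY
  have dW := mdifferentiableAt_projConn h hζ hp hY
  have he : (fun q => prodMetric c₁ c₂ (projConn c₁ c₂ E₁ E₂ ζ q (Y q)) (E₁ q)) =ᶠ[𝓝 p]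
      fun q => prodMetric c₁ c₂ (mvfderiv (𝓡 2) ζ q (Y q)) (E₁ q) := by
    filter_upwards [hU] with q hq
    rw [projConn, prodMetric_add_left, prodMetric_smul_left, prodMetric_smul_left,
      h.metric₁₁ q hq, h.symm.metric₁₂ q hq]
    ring
  have h1 := mvfderiv_prodMetric (c₁ := c₁) (c₂ := c₂) dW d₁ v
  rw [he.mvfderiv_eq, mvfderiv_prodMetric dY d₁] at h1
  have h2 := prodMetric_mvfderiv_add_eq_zero h.isOpen hp d₁ d₁ h.metric₁₁ v
  have h3 : prodMetric c₁ c₂ (projConn c₁ c₂ E₁ E₂ ζ p (Y p)) (mvfderiv (𝓡 2) E₁ p v) =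
      prodMetric c₁ c₂ (mvfderiv (𝓡 2) ζ p (Y p)) (E₂ p) *
          prodMetric c₁ c₂ (mvfderiv (𝓡 2) E₁ p v) (E₂ p) := by
    rw [prodMetric_comm _ _ (E₁ p)] at h2
    rw [prodMetric_comm, projConn, prodMetric_add_right, prodMetric_smul_right,
      prodMetric_smul_right]
    linear_combination (1 / 2 * prodMetric c₁ c₂ (mvfderiv (𝓡 2) ζ p (Y p)) (E₁ p)) * h2
  linarith

/-- The curvature of the projected connection of a field `ζ` in the plane field. -/
theorem prodMetric_projConn_curvature {U : Set M} {E₁ E₂ ζ : M → V6}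
    (h : IsOrthonormalFieldsOn c₁ c₂ U E₁ E₂) (hζ : ContMDiffOn (𝓡 2) 𝓘(ℝ, V6) ∞ ζ U)
    (hspan : ∀ q ∈ U, ζ q = prodMetric c₁ c₂ (ζ q) (E₁ q) • E₁ q +
      prodMetric c₁ c₂ (ζ q) (E₂ q) • E₂ q) {p : M} (hp : p ∈ U)
    {X Y : (q : M) → TangentSpace (𝓡 2) q} (hX : DiffFieldAt X p) (hY : DiffFieldAt Y p) :
    prodMetric c₁ c₂ (mvfderiv (𝓡 2) (fun q => projConn c₁ c₂ E₁ E₂ ζ q (Y q)) p (X p) -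
        mvfderiv (𝓡 2) (fun q => projConn c₁ c₂ E₁ E₂ ζ q (X q)) p (Y p) -
        mvfderiv (𝓡 2) ζ p (VectorField.mlieBracket (𝓡 2) X Y p)) (E₁ p) =
      prodMetric c₁ c₂ (ζ p) (E₂ p) *
        (prodMetric c₁ c₂ (mvfderiv (𝓡 2) E₁ p (X p)) (mvfderiv (𝓡 2) E₂ p (Y p)) -
          prodMetric c₁ c₂ (mvfderiv (𝓡 2) E₁ p (Y p)) (mvfderiv (𝓡 2) E₂ p (X p))) := by
  have hU := h.isOpen.mem_nhds hp
  have d₁ := (h.smooth₁.contMDiffAt hU).mdifferentiableAt (by simp)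
  have d₂ := (h.smooth₂.contMDiffAt hU).mdifferentiableAt (by simp)
  have dζ := (hζ.contMDiffAt hU).mdifferentiableAt (by simp)
  have dz₁ := dζ.bilinear_apply (prodMetricL c₁ c₂) d₁
  have dz₂ := dζ.bilinear_apply (prodMetricL c₁ c₂) d₂
  rw [prodMetric_sub_left, prodMetric_sub_left, prodMetric_mvfderiv_projConn h hζ hp hY,
    prodMetric_mvfderiv_projConn h hζ hp hX,
    -- The bracket term cancels the second derivatives of `ζ`.
    hζ.mvfderiv_mlieBracket h.isOpen hp ENat.LEInfty.out hX hY, prodMetric_sub_left]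
  have he : ζ =ᶠ[𝓝 p] fun q => prodMetricL c₁ c₂ (ζ q) (E₁ q) • E₁ q +
      prodMetricL c₁ c₂ (ζ q) (E₂ q) • E₂ q := Filter.eventually_of_mem hU hspan
  -- With `ζ = z₁ E₁ + z₂ E₂` the derivatives of `z₁, z₂` cancel, and the `z₁` terms are symmetric
  -- in `X` and `Y`. Only the `z₂` term survives the antisymmetrization.
  have hD : ∀ v, mvfderiv (𝓡 2) ζ p v =
      (mvfderiv (𝓡 2) (fun q => prodMetricL c₁ c₂ (ζ q) (E₁ q)) p v • E₁ p +
        prodMetric c₁ c₂ (ζ p) (E₁ p) • mvfderiv (𝓡 2) E₁ p v) +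
      (mvfderiv (𝓡 2) (fun q => prodMetricL c₁ c₂ (ζ q) (E₂ q)) p v • E₂ p +
        prodMetric c₁ c₂ (ζ p) (E₂ p) • mvfderiv (𝓡 2) E₂ p v) := by
    intro v
    have m₁ := MDifferentiableAt.bilinear_apply (ContinuousLinearMap.lsmul ℝ ℝ) dz₁ d₁
    have m₂ := MDifferentiableAt.bilinear_apply (ContinuousLinearMap.lsmul ℝ ℝ) dz₂ d₂
    have h1 := mvfderiv_fun_add m₁ m₂
    have h2 := congrArg (fun T => T v) (he.mvfderiv_eq.trans h1)
    refine h2.trans ?_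
    exact congrArg₂ (· + ·) (mvfderiv_smul_field dz₁ d₁ v) (mvfderiv_smul_field dz₂ d₂ v)
  have k₁ := fun v => prodMetric_mvfderiv_add_eq_zero h.isOpen hp d₁ d₁ h.metric₁₁ v
  have k₂ := fun v => prodMetric_mvfderiv_add_eq_zero h.isOpen hp d₂ d₂ h.metric₂₂ v
  have n₁ : ∀ v, prodMetric c₁ c₂ (E₁ p) (mvfderiv (𝓡 2) E₁ p v) = 0 := fun v => by
    have := k₁ v
    rw [prodMetric_comm] at this
    linarith
  have n₂ : ∀ v, prodMetric c₁ c₂ (mvfderiv (𝓡 2) E₂ p v) (E₂ p) = 0 := fun v => by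
    have := k₂ v
    rw [prodMetric_comm _ _ (E₂ p)] at this
    linarith
  rw [hD (X p), hD (Y p)]
  simp only [prodMetric_add_left, prodMetric_smul_left, n₁, n₂, h.metric₂₂ p hp, h.metric₁₂ p hp]
  rw [prodMetric_comm _ _ (E₂ p) (mvfderiv (𝓡 2) E₁ p (X p)),
    prodMetric_comm _ _ (E₂ p) (mvfderiv (𝓡 2) E₁ p (Y p)),
    prodMetric_comm _ _ (mvfderiv (𝓡 2) E₂ p (X p)) (mvfderiv (𝓡 2) E₁ p (Y p)),
    prodMetric_comm _ _ (mvfderiv (𝓡 2) E₂ p (Y p)) (mvfderiv (𝓡 2) E₁ p (X p)),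
    prodMetric_comm _ _ (mvfderiv (𝓡 2) E₁ p (Y p)) (mvfderiv (𝓡 2) E₁ p (X p))]
  ring

end Surface
end ProductSurface

namespace ProductSurface

/-! ### Gaussian and normal curvature from the adapted frame. -/

section Surface

variable {M : Type*} [TopologicalSpace M] [ChartedSpace (EuclideanSpace ℝ (Fin 2)) M]
  [IsManifold (𝓡 2) ∞ M] {c₁ c₂ : ℝ} {ψ : M → V6}

/-- The Levi-Civita derivative of a smooth field along a smooth field, and its image in the ambient
vector space. -/
theorem leviCivita_field (hψ : IsImmersedSurface c₁ c₂ ψ) {U : Set M} (hU : IsOpen U)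
    {e₁ e₂ Y Z : (q : M) → TangentSpace (𝓡 2) q} (he₁ : IsTangentField e₁ U)
    (he₂ : IsTangentField e₂ U) (hf : ∀ q ∈ U, IsTangentFrameAt c₁ c₂ ψ q (e₁ q) (e₂ q))
    (hY : IsTangentField Y U) (hZ : IsTangentField Z U) {p : M} (hp : p ∈ U) :
    DiffFieldAt (fun q => leviCivita c₁ c₂ ψ Z q (Y q)) p ∧
      (fun q => push ψ q (leviCivita c₁ c₂ ψ Z q (Y q))) =ᶠ[𝓝 p]
        fun q => projConn c₁ c₂ (fun q => push ψ q (e₁ q)) (fun q => push ψ q (e₂ q))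
          (fun q => push ψ q (Z q)) q (Y q) := by
  have hD := (contMDiffOn_push hψ hU hZ).mvfderiv_apply (m := ∞) hU hY (by simp)
  have s₁ := hD.bilinear_apply (prodMetricL c₁ c₂) (contMDiffOn_push hψ hU he₁)
  have s₂ := hD.bilinear_apply (prodMetricL c₁ c₂) (contMDiffOn_push hψ hU he₂)
  -- Identifying the second covariant derivative requires the first one to be a differentiable
  -- section; near `p` it agrees with this smooth combination of the frame.
  have hW := (IsTangentField.smul_add_smul s₁ he₁ s₂ he₂).diffFieldAt hU hp
  have heq : ∀ q ∈ U, leviCivita c₁ c₂ ψ Z q (Y q) =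
      prodMetricL c₁ c₂ (mvfderiv (𝓡 2) (fun q => push ψ q (Z q)) q (Y q)) (push ψ q (e₁ q)) •
          e₁ q +
        prodMetricL c₁ c₂ (mvfderiv (𝓡 2) (fun q => push ψ q (Z q)) q (Y q)) (push ψ q (e₂ q)) •
          e₂ q := fun q hq => by
    rw [leviCivita_eq_tanPart hψ (hf q hq) (hZ.diffFieldAt hU hq), (hf q hq).tanPart_eq]
    rfl
  refine ⟨hW.congr_of_eventuallyEq ?_, ?_⟩
  · filter_upwards [hU.mem_nhds hp] with q hq
    rw [heq q hq]
  · filter_upwards [hU.mem_nhds hp] with q hq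
    rw [heq q hq, push_add, push_smul, push_smul]
    rfl

namespace IsAdaptedFrameOn

variable {θ₁ θ₂ : ℝ} {U : Set M} {e₁ e₂ : (q : M) → TangentSpace (𝓡 2) q} {a₁ a₂ b₁ b₂ : M → V3}

theorem isOrthonormalFieldsOn_tangent (hψ : IsImmersedSurface c₁ c₂ ψ)
    (h : IsAdaptedFrameOn c₁ c₂ ψ θ₁ θ₂ U e₁ e₂ a₁ a₂ b₁ b₂) :
    IsOrthonormalFieldsOn c₁ c₂ U (fun q => push ψ q (e₁ q)) (fun q => push ψ q (e₂ q)) :=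
  ⟨h.isOpen, contMDiffOn_push hψ h.isOpen h.field₁, contMDiffOn_push hψ h.isOpen h.field₂,
    fun _ hq => (h.isTangentFrameAt hq).metric₁₁, fun _ hq => (h.isTangentFrameAt hq).metric₂₂,
    fun _ hq => (h.isTangentFrameAt hq).metric₁₂⟩

theorem isOrthonormalFieldsOn_normal
    (h : IsAdaptedFrameOn c₁ c₂ ψ θ₁ θ₂ U e₁ e₂ a₁ a₂ b₁ b₂) :
    IsOrthonormalFieldsOn c₁ c₂ U (adaptedNormal θ₁ a₁ b₁) (adaptedNormal θ₂ a₂ b₂) :=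
  ⟨h.isOpen, h.isNormalField₁.1, h.isNormalField₂.1, fun _ hq => (h.isOrthonormalAt hq).normal₁₁,
    fun _ hq => (h.isOrthonormalAt hq).normal₂₂, fun _ hq => (h.isOrthonormalAt hq).normal₁₂⟩

/-- The derivatives of the frames `a₁, a₂` and `b₁, b₂` have inner products given by the curvatures
of the two space forms. -/
theorem form_mvfderiv_frames (hψ : IsImmersedSurface c₁ c₂ ψ)
    (h : IsAdaptedFrameOn c₁ c₂ ψ θ₁ θ₂ U e₁ e₂ a₁ a₂ b₁ b₂) {p : M} (hp : p ∈ U)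
    (v w : TangentSpace (𝓡 2) p) :
    form c₁ (mvfderiv (𝓡 2) a₁ p v) (mvfderiv (𝓡 2) a₂ p w) =
        c₁ * (Real.cos θ₁ * indMetric c₁ c₂ ψ p v (e₁ p)) *
          (Real.cos θ₂ * indMetric c₁ c₂ ψ p w (e₂ p)) ∧
      form c₂ (mvfderiv (𝓡 2) b₁ p v) (mvfderiv (𝓡 2) b₂ p w) =
        c₂ * (Real.sin θ₁ * indMetric c₁ c₂ ψ p v (e₁ p)) *
          (Real.sin θ₂ * indMetric c₁ c₂ ψ p w (e₂ p)) := by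
  obtain ⟨da₁, da₂, db₁, db₂⟩ := h.mdifferentiableAt hp
  have hd := (hψ.smooth p).mdifferentiableAt (by simp)
  have hn := h.isOpen.mem_nhds hp
  have hπ₁ : MDifferentiableAt (𝓡 2) 𝓘(ℝ, V3) (fun q => (ψ q).1) p :=
    (ContinuousLinearMap.fst ℝ V3 V3).mdifferentiableAt.comp p hd
  have hπ₂ : MDifferentiableAt (𝓡 2) 𝓘(ℝ, V3) (fun q => (ψ q).2) p :=
    (ContinuousLinearMap.snd ℝ V3 V3).mdifferentiableAt.comp p hd
  have hfst : ∀ v, mvfderiv (𝓡 2) (fun q => (ψ q).1) p v = (push ψ p v).1 :=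
    mvfderiv_clm_comp (ContinuousLinearMap.fst ℝ V3 V3) hd
  have hsnd : ∀ v, mvfderiv (𝓡 2) (fun q => (ψ q).2) p v = (push ψ p v).2 :=
    mvfderiv_clm_comp (ContinuousLinearMap.snd ℝ V3 V3) hd
  have hpush : ∀ v, push ψ p v =
      indMetric c₁ c₂ ψ p v (e₁ p) • (Real.cos θ₁ • a₁ p, Real.sin θ₁ • b₁ p) +
        indMetric c₁ c₂ ψ p v (e₂ p) • (Real.cos θ₂ • a₂ p, Real.sin θ₂ • b₂ p) := fun v => by
    conv_lhs => rw [(h.isTangentFrameAt hp).eq_sum v]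
    rw [push_add, push_smul, push_smul, h.push₁ p hp, h.push₂ p hp]
  constructor
  · rw [form_mvfderiv_mvfderiv (π := fun q => (ψ q).1) (p := p) (hψ.mem_fst p) hπ₁ da₁ da₂
      (Filter.eventually_of_mem hn h.tangent_a₁)
      (Filter.eventually_of_mem hn h.tangent_a₂) (Filter.eventually_of_mem hn h.form_a₁₁)
      (Filter.eventually_of_mem hn h.form_a₂₂) (Filter.eventually_of_mem hn h.form_a₁₂), hfst, hfst,
      hpush v, hpush w]
    simp only [Prod.fst_add, Prod.smul_fst, form_add_right, form_smul_right, h.form_table hp]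
    ring
  · rw [form_mvfderiv_mvfderiv (π := fun q => (ψ q).2) (p := p) (hψ.mem_snd p) hπ₂ db₁ db₂
      (Filter.eventually_of_mem hn h.tangent_b₁)
      (Filter.eventually_of_mem hn h.tangent_b₂) (Filter.eventually_of_mem hn h.form_b₁₁)
      (Filter.eventually_of_mem hn h.form_b₂₂) (Filter.eventually_of_mem hn h.form_b₁₂), hsnd, hsnd,
      hpush v, hpush w]
    simp only [Prod.snd_add, Prod.smul_snd, form_add_right, form_smul_right, h.form_table hp]
    ring

/-- For `Eᵢ = dψ eᵢ`, `form_mvfderiv_frames` gives `⟨D_v E₁, D_w E₂⟩ = K g(v, e₁) g(w, e₂)` with the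
asserted constant `K`. Antisymmetrizing produces the determinant of `X, Y` in the frame, whose
square is the Gram determinant. -/
theorem isGaussCurvatureAt (hψ : IsImmersedSurface c₁ c₂ ψ)
    (h : IsAdaptedFrameOn c₁ c₂ ψ θ₁ θ₂ U e₁ e₂ a₁ a₂ b₁ b₂) {p : M} (hp : p ∈ U) :
    IsGaussCurvatureAt c₁ c₂ ψ p
      (c₁ * Real.cos θ₁ ^ 2 * Real.cos θ₂ ^ 2 + c₂ * Real.sin θ₁ ^ 2 * Real.sin θ₂ ^ 2) := by
  intro U' X Y hU' hp' hX' hY'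
  have hV := h.isOpen.inter hU'
  have hpV : p ∈ U ∩ U' := ⟨hp, hp'⟩
  have hX := hX'.mono (Set.inter_subset_right (s := U))
  have hY := hY'.mono (Set.inter_subset_right (s := U))
  have he₁ := h.field₁.mono (Set.inter_subset_left (t := U'))
  have he₂ := h.field₂.mono (Set.inter_subset_left (t := U'))
  have hfr := fun q (hq : q ∈ U ∩ U') => h.isTangentFrameAt hq.1
  have hf := h.isTangentFrameAt hp
  have dX : DiffFieldAt X p := IsTangentField.diffFieldAt hX hV hpV
  have dY : DiffFieldAt Y p := IsTangentField.diffFieldAt hY hV hpV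
  obtain ⟨w₁, g₁⟩ := leviCivita_field hψ hV he₁ he₂ hfr hY hY hpV
  obtain ⟨w₂, g₂⟩ := leviCivita_field hψ hV he₁ he₂ hfr hX hY hpV
  have hO := (h.isOrthonormalFieldsOn_tangent hψ).mono hV Set.inter_subset_left
  have hYs := contMDiffOn_push hψ hV hY
  have hspan : ∀ q ∈ U ∩ U', push ψ q (Y q) =
      prodMetric c₁ c₂ (push ψ q (Y q)) (push ψ q (e₁ q)) • push ψ q (e₁ q) +
        prodMetric c₁ c₂ (push ψ q (Y q)) (push ψ q (e₂ q)) • push ψ q (e₂ q) := by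
    intro q hq
    conv_lhs => rw [(hfr q hq).eq_sum (Y q), push_add, push_smul, push_smul]
    rfl
  have R₁ := prodMetric_projConn_curvature hO hYs hspan hpV dX dY
  -- The `E₂`-component comes from the same formula with the frame vectors exchanged; the projection
  -- does not see their order.
  have R₂ := prodMetric_projConn_curvature hO.symm hYs
    (fun q hq => (hspan q hq).trans (add_comm _ _)) hpV dX dY
  rw [projConn_swap] at R₂
  have hcurv : ∀ z, indMetric c₁ c₂ ψ p (curvature c₁ c₂ ψ X Y Y p) z =
      prodMetric c₁ c₂ (mvfderiv (𝓡 2) (fun q => projConn c₁ c₂ (fun q => push ψ q (e₁ q))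
          (fun q => push ψ q (e₂ q)) (fun q => push ψ q (Y q)) q (Y q)) p (X p) -
        mvfderiv (𝓡 2) (fun q => projConn c₁ c₂ (fun q => push ψ q (e₁ q))
          (fun q => push ψ q (e₂ q)) (fun q => push ψ q (Y q)) q (X q)) p (Y p) -
        mvfderiv (𝓡 2) (fun q => push ψ q (Y q)) p (VectorField.mlieBracket (𝓡 2) X Y p))
        (push ψ p z) := by
    intro z
    rw [curvature, leviCivita_eq_tanPart hψ hf w₁, leviCivita_eq_tanPart hψ hf w₂,
      leviCivita_eq_tanPart hψ hf dY, g₁.mvfderiv_eq, g₂.mvfderiv_eq]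
    simp only [indMetric, push_sub, prodMetric_sub_left]
    exact congrArg₂ (· - ·) (congrArg₂ (· - ·) (hf.indMetric_tanPart _ z)
      (hf.indMetric_tanPart _ z)) (hf.indMetric_tanPart _ z)
  have hpush : push ψ p (X p) = indMetric c₁ c₂ ψ p (X p) (e₁ p) • push ψ p (e₁ p) +
      indMetric c₁ c₂ ψ p (X p) (e₂ p) • push ψ p (e₂ p) := by
    conv_lhs => rw [hf.eq_sum (X p)]
    rw [push_add, push_smul, push_smul]
  have hmetric : ∀ v w, indMetric c₁ c₂ ψ p v w =
      indMetric c₁ c₂ ψ p v (e₁ p) * indMetric c₁ c₂ ψ p w (e₁ p) +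
        indMetric c₁ c₂ ψ p v (e₂ p) * indMetric c₁ c₂ ψ p w (e₂ p) := by
    intro v w
    refine (congrArg _ (hf.eq_sum w)).trans ?_
    rw [indMetric_add_right, indMetric_smul_right, indMetric_smul_right]
    ring
  rw [hcurv, hpush, prodMetric_add_right, prodMetric_smul_right, prodMetric_smul_right, R₁, R₂,
    hmetric (X p) (X p), hmetric (Y p) (Y p), hmetric (X p) (Y p),
    prodMetric_comm _ _ (mvfderiv (𝓡 2) (fun q => push ψ q (e₂ q)) p (X p)),
    prodMetric_comm _ _ (mvfderiv (𝓡 2) (fun q => push ψ q (e₂ q)) p (Y p))]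
  simp only [h.mvfderiv_push₁ hp, h.mvfderiv_push₂ hp]
  simp only [prodMetric, form_smul_smul, h.form_mvfderiv_frames hψ hp]
  change _ * (indMetric c₁ c₂ ψ p (Y p) (e₂ p) * _) +
    _ * (indMetric c₁ c₂ ψ p (Y p) (e₁ p) * _) = _
  ring

/-- For the normal frame `⟨D_v ξ₁, D_w ξ₂⟩` is `(c₁ + c₂) sin θ₁ cos θ₁ sin θ₂ cos θ₂ g(v, e₁) g(w,
e₂)`. The given bases need to be orthonormal only at `p`; each enters through its determinant
against the adapted basis, of absolute value one. -/
theorem isNormalCurvatureAt (hψ : IsImmersedSurface c₁ c₂ ψ)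
    (h : IsAdaptedFrameOn c₁ c₂ ψ θ₁ θ₂ U e₁ e₂ a₁ a₂ b₁ b₂) (hC₁ : 0 < Real.cos θ₁)
    (hC₂ : 0 < Real.cos θ₂) (hS₁ : 0 < Real.sin θ₁) (hS₂ : 0 < Real.sin θ₂) {p : M} (hp : p ∈ U) :
    IsNormalCurvatureAt c₁ c₂ ψ p
      (|(c₁ + c₂) / 4| * Real.sin (2 * θ₁) * Real.sin (2 * θ₂)) := by
  intro U' X Y ξ ζ hU' hp' hX' hY' hξ' hζ' ho
  have hV := h.isOpen.inter hU'
  have hpV : p ∈ U ∩ U' := ⟨hp, hp'⟩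
  have dX : DiffFieldAt X p := hX'.diffFieldAt hU' hp'
  have dY : DiffFieldAt Y p := hY'.diffFieldAt hU' hp'
  have hO := h.isOrthonormalFieldsOn_normal.mono hV Set.inter_subset_left
  have hζs := hζ'.1.mono (Set.inter_subset_right (s := U))
  have hspan := fun q (hq : q ∈ U ∩ U') => h.eq_sum_of_isNormalVector hψ hq.1 (hζ'.2 q hq.2)
  have R₁ := prodMetric_projConn_curvature hO hζs hspan hpV dX dY
  have R₂ := prodMetric_projConn_curvature hO.symm hζs
    (fun q hq => (hspan q hq).trans (add_comm _ _)) hpV dX dY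
  rw [projConn_swap] at R₂
  have hconn : ∀ W : (q : M) → TangentSpace (𝓡 2) q,
      (fun q => normalConn c₁ c₂ ψ ζ q (W q)) =ᶠ[𝓝 p] fun q =>
        projConn c₁ c₂ (adaptedNormal θ₁ a₁ b₁) (adaptedNormal θ₂ a₂ b₂) ζ q (W q) := fun W =>
    Filter.eventually_of_mem (h.isOpen.mem_nhds hp) fun q hq => h.normalConn_eq hψ hq ζ (W q)
  have hon := h.isOrthonormalAt hp
  have hξs := h.eq_sum_of_isNormalVector hψ hp ho.normal₁
  have hζp := h.eq_sum_of_isNormalVector hψ hp ho.normal₂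
  have h₂₁ : prodMetric c₁ c₂ (adaptedNormal θ₂ a₂ b₂ p) (adaptedNormal θ₁ a₁ b₁ p) = 0 := by
    rw [prodMetric_comm, hon.normal₁₂]
  have hcurv : prodMetric c₁ c₂ (normalCurvature c₁ c₂ ψ X Y ζ p) (ξ p) =
      (prodMetric c₁ c₂ (ξ p) (adaptedNormal θ₁ a₁ b₁ p) *
          prodMetric c₁ c₂ (ζ p) (adaptedNormal θ₂ a₂ b₂ p) -
        prodMetric c₁ c₂ (ξ p) (adaptedNormal θ₂ a₂ b₂ p) *
          prodMetric c₁ c₂ (ζ p) (adaptedNormal θ₁ a₁ b₁ p)) *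
      (prodMetric c₁ c₂ (mvfderiv (𝓡 2) (adaptedNormal θ₁ a₁ b₁) p (X p))
          (mvfderiv (𝓡 2) (adaptedNormal θ₂ a₂ b₂) p (Y p)) -
        prodMetric c₁ c₂ (mvfderiv (𝓡 2) (adaptedNormal θ₁ a₁ b₁) p (Y p))
          (mvfderiv (𝓡 2) (adaptedNormal θ₂ a₂ b₂) p (X p))) := by
    rw [prodMetric_comm _ _ (mvfderiv (𝓡 2) (adaptedNormal θ₂ a₂ b₂) p (X p)),
      prodMetric_comm _ _ (mvfderiv (𝓡 2) (adaptedNormal θ₂ a₂ b₂) p (Y p))] at R₂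
    rw [normalCurvature, h.normalConn_eq hψ hp, h.normalConn_eq hψ hp, h.normalConn_eq hψ hp,
      (hconn Y).mvfderiv_eq, (hconn X).mvfderiv_eq]
    conv_lhs => rw [hξs]
    simp only [prodMetric_sub_left, prodMetric_add_left, prodMetric_add_right, prodMetric_smul_left,
      prodMetric_smul_right, hon.normal₁₁, hon.normal₂₂, hon.normal₁₂, h₂₁] at R₁ R₂ ⊢
    linear_combination prodMetric c₁ c₂ (ξ p) (adaptedNormal θ₁ a₁ b₁ p) * R₁ +
      prodMetric c₁ c₂ (ξ p) (adaptedNormal θ₂ a₂ b₂ p) * R₂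
  have hfr := h.isTangentFrameAt hp
  have hx := hfr.eq_sum (X p)
  have hy := hfr.eq_sum (Y p)
  have t₁₁ := ho.tangent₁₁
  have t₂₂ := ho.tangent₂₂
  have t₁₂ := ho.tangent₁₂
  have n₁₁ := ho.normal₁₁
  have n₂₂ := ho.normal₂₂
  have n₁₂ := ho.normal₁₂
  have hf₂₁ : indMetric c₁ c₂ ψ p (e₂ p) (e₁ p) = 0 := by rw [indMetric_comm, hfr.metric₁₂]
  rw [hcurv]
  simp only [h.mvfderiv_adaptedNormal₁ hp, h.mvfderiv_adaptedNormal₂ hp]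
  simp only [prodMetric, form_smul_smul, h.form_mvfderiv_frames hψ hp]
  simp only [← prodMetric.eq_1]
  generalize indMetric c₁ c₂ ψ p (X p) (e₁ p) = x₁ at *
  generalize indMetric c₁ c₂ ψ p (X p) (e₂ p) = x₂ at *
  generalize indMetric c₁ c₂ ψ p (Y p) (e₁ p) = y₁ at *
  generalize indMetric c₁ c₂ ψ p (Y p) (e₂ p) = y₂ at *
  generalize prodMetric c₁ c₂ (ξ p) (adaptedNormal θ₁ a₁ b₁ p) = r₁ at *
  generalize prodMetric c₁ c₂ (ξ p) (adaptedNormal θ₂ a₂ b₂ p) = r₂ at *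
  generalize prodMetric c₁ c₂ (ζ p) (adaptedNormal θ₁ a₁ b₁ p) = s₁ at *
  generalize prodMetric c₁ c₂ (ζ p) (adaptedNormal θ₂ a₂ b₂ p) = s₂ at *
  rw [hx] at t₁₁ t₁₂
  rw [hy] at t₂₂ t₁₂
  rw [hξs] at n₁₁ n₁₂
  rw [hζp] at n₂₂ n₁₂
  simp only [indMetric_add_left, indMetric_add_right, indMetric_smul_left, indMetric_smul_right,
    hfr.metric₁₁, hfr.metric₂₂, hfr.metric₁₂, hf₂₁] at t₁₁ t₂₂ t₁₂
  simp only [prodMetric_add_left, prodMetric_add_right, prodMetric_smul_left,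
    prodMetric_smul_right, hon.normal₁₁, hon.normal₂₂, hon.normal₁₂, h₂₁] at n₁₁ n₂₂ n₁₂
  -- Lagrange's identity: the squared determinant is the product of the squared lengths minus the
  -- squared inner product.
  have unit : ∀ {x₁ x₂ y₁ y₂ : ℝ}, x₁ * x₁ + x₂ * x₂ = 1 → y₁ * y₁ + y₂ * y₂ = 1 →
      x₁ * y₁ + x₂ * y₂ = 0 → |x₁ * y₂ - x₂ * y₁| = 1 := by
    intro x₁ x₂ y₁ y₂ h1 h2 h3
    rw [← abs_one, ← sq_eq_sq_iff_abs_eq_abs]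
    linear_combination h2 + (y₁ * y₁ + y₂ * y₂) * h1 - (x₁ * y₁ + x₂ * y₂) * h3
  have u := unit (by linarith : x₁ * x₁ + x₂ * x₂ = 1) (by linarith : y₁ * y₁ + y₂ * y₂ = 1)
    (by linarith)
  have u' := unit (by linarith : r₁ * r₁ + r₂ * r₂ = 1) (by linarith : s₁ * s₁ + s₂ * s₂ = 1)
    (by linarith)
  have hfac : (r₁ * s₂ - r₂ * s₁) *
      (Real.sin θ₁ * Real.sin θ₂ * (c₁ * (Real.cos θ₁ * x₁) * (Real.cos θ₂ * y₂)) +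
          -Real.cos θ₁ * -Real.cos θ₂ * (c₂ * (Real.sin θ₁ * x₁) * (Real.sin θ₂ * y₂)) -
        (Real.sin θ₁ * Real.sin θ₂ * (c₁ * (Real.cos θ₁ * y₁) * (Real.cos θ₂ * x₂)) +
          -Real.cos θ₁ * -Real.cos θ₂ * (c₂ * (Real.sin θ₁ * y₁) * (Real.sin θ₂ * x₂)))) =
      (r₁ * s₂ - r₂ * s₁) * (x₁ * y₂ - x₂ * y₁) * ((c₁ + c₂) / 4) *
        (2 * Real.sin θ₁ * Real.cos θ₁) * (2 * Real.sin θ₂ * Real.cos θ₂) := by ring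
  rw [hfac, abs_mul, abs_mul, abs_mul, abs_mul, u, u', Real.sin_two_mul, Real.sin_two_mul,
    abs_of_pos (by positivity : 0 < 2 * Real.sin θ₁ * Real.cos θ₁),
    abs_of_pos (by positivity : 0 < 2 * Real.sin θ₂ * Real.cos θ₂)]
  ring

end IsAdaptedFrameOn

end Surface
end ProductSurface

end

/-! ### The theorem, assembled from the adapted frames. -/

theorem mainTheorem8 {M : Type*} [TopologicalSpace M]
    [ChartedSpace (EuclideanSpace ℝ (Fin 2)) M] [IsManifold (𝓡 2) ∞ M]
    (c₁ c₂ : ℝ) (hc : ¬(c₁ = 0 ∧ c₂ = 0)) (ψ : M → ProductSurface.V6)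
    (hψ : ProductSurface.IsImmersedSurface c₁ c₂ ψ)
    (lam₁ lam₂ θ₁ θ₂ : ℝ) (hlam₁ : lam₁ ∈ Set.Ioo (-1 : ℝ) 1) (hlam₂ : lam₂ ∈ Set.Ioo (-1 : ℝ) 1)
    (hlam : 0 < lam₂ - lam₁)
    (hf : ∀ p, ProductSurface.IsEigenvalueAt c₁ c₂ ψ p lam₁ ∧
      ProductSurface.IsEigenvalueAt c₁ c₂ ψ p lam₂)
    (hθ₁ : θ₁ ∈ Set.Icc 0 (Real.pi / 2)) (hθ₂ : θ₂ ∈ Set.Icc 0 (Real.pi / 2))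
    (hcos₁ : lam₁ = Real.cos (2 * θ₁)) (hcos₂ : lam₂ = Real.cos (2 * θ₂)) :
    (∀ p₀ : M, ∃ U : Set M, IsOpen U ∧ p₀ ∈ U ∧
      ∃ (e₁ e₂ : (q : M) → TangentSpace (𝓡 2) q) (ξ₁ ξ₂ : M → ProductSurface.V6) (μ₁ μ₂ : M → ℝ),
        ProductSurface.IsTangentField e₁ U ∧ ProductSurface.IsTangentField e₂ U ∧
        ProductSurface.IsNormalField c₁ c₂ ψ ξ₁ U ∧ ProductSurface.IsNormalField c₁ c₂ ψ ξ₂ U ∧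
        ContMDiffOn (𝓡 2) 𝓘(ℝ, ℝ) ∞ μ₁ U ∧ ContMDiffOn (𝓡 2) 𝓘(ℝ, ℝ) ∞ μ₂ U ∧
        ∀ p ∈ U,
          ProductSurface.IsOrthonormalAt c₁ c₂ ψ p (e₁ p) (e₂ p) (ξ₁ p) (ξ₂ p) ∧
          ProductSurface.fTensor c₁ c₂ ψ p (e₁ p) = Real.cos (2 * θ₁) • e₁ p ∧
          ProductSurface.fTensor c₁ c₂ ψ p (e₂ p) = Real.cos (2 * θ₂) • e₂ p ∧
          ProductSurface.tTensor c₁ c₂ ψ p (ξ₁ p) = -Real.cos (2 * θ₁) • ξ₁ p ∧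
          ProductSurface.tTensor c₁ c₂ ψ p (ξ₂ p) = -Real.cos (2 * θ₂) • ξ₂ p ∧
          ProductSurface.shape c₁ c₂ ψ ξ₁ p (e₁ p) = 0 ∧
          ProductSurface.shape c₁ c₂ ψ ξ₁ p (e₂ p) = μ₁ p • e₂ p ∧
          ProductSurface.shape c₁ c₂ ψ ξ₂ p (e₁ p) = μ₂ p • e₁ p ∧
          ProductSurface.shape c₁ c₂ ψ ξ₂ p (e₂ p) = 0 ∧
          ∀ v : TangentSpace (𝓡 2) p,
            ProductSurface.indMetric c₁ c₂ ψ p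
                (ProductSurface.leviCivita c₁ c₂ ψ e₁ p v) (e₂ p) =
              (Real.cos θ₁ * Real.sin θ₁ * μ₁ p * ProductSurface.indMetric c₁ c₂ ψ p v (e₂ p) +
                Real.cos θ₂ * Real.sin θ₂ * μ₂ p * ProductSurface.indMetric c₁ c₂ ψ p v (e₁ p)) /
              (Real.cos θ₁ ^ 2 - Real.cos θ₂ ^ 2) ∧
            ProductSurface.prodMetric c₁ c₂
                (ProductSurface.normalConn c₁ c₂ ψ ξ₁ p v) (ξ₂ p) =
              (Real.cos θ₁ * Real.sin θ₁ * μ₂ p * ProductSurface.indMetric c₁ c₂ ψ p v (e₁ p) +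
                Real.cos θ₂ * Real.sin θ₂ * μ₁ p * ProductSurface.indMetric c₁ c₂ ψ p v (e₂ p)) /
              (Real.cos θ₁ ^ 2 - Real.cos θ₂ ^ 2)) ∧
    (∀ p : M, ProductSurface.IsGaussCurvatureAt c₁ c₂ ψ p
      (c₁ * Real.cos θ₁ ^ 2 * Real.cos θ₂ ^ 2 + c₂ * Real.sin θ₁ ^ 2 * Real.sin θ₂ ^ 2)) ∧
    (∀ p : M, ProductSurface.IsNormalCurvatureAt c₁ c₂ ψ p
      (|(c₁ + c₂) / 4| * Real.sin (2 * θ₁) * Real.sin (2 * θ₂))) := by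
  -- An eigenvalue in the open interval excludes `θ = 0` and `θ = π / 2`, where an eigenvector lies
  -- in one factor and `b` or `a` cannot be obtained by normalization.
  have hpos : ∀ θ ∈ Set.Icc 0 (Real.pi / 2), Real.cos (2 * θ) ∈ Set.Ioo (-1 : ℝ) 1 →
      0 < Real.cos θ ∧ 0 < Real.sin θ := by
    intro θ hθ h
    have hc := Real.cos_nonneg_of_mem_Icc (x := θ) ⟨by linarith [hθ.1, Real.pi_pos], hθ.2⟩
    have hs := Real.sin_nonneg_of_nonneg_of_le_pi hθ.1 (by linarith [hθ.2, Real.pi_pos])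
    have h1 := Real.sin_sq_add_cos_sq θ
    rw [Real.cos_two_mul] at h
    refine ⟨lt_of_le_of_ne hc fun h0 => ?_, lt_of_le_of_ne hs fun h0 => ?_⟩
    · rw [← h0] at h
      linarith [h.1]
    · rw [← h0] at h1
      linarith [h.2]
  subst hcos₁ hcos₂
  obtain ⟨hC₁, hS₁⟩ := hpos θ₁ hθ₁ hlam₁
  obtain ⟨hC₂, hS₂⟩ := hpos θ₂ hθ₂ hlam₂
  have hne : Real.cos (2 * θ₁) ≠ Real.cos (2 * θ₂) := by linarith
  have hden : Real.cos θ₁ ^ 2 - Real.cos θ₂ ^ 2 ≠ 0 := by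
    intro h0
    apply hne
    rw [Real.cos_two_mul, Real.cos_two_mul]
    linarith
  have hex := ProductSurface.exists_isAdaptedFrameOn hψ hC₁ hC₂ hS₁ hS₂ hne hf
  refine ⟨fun p₀ => ?_, fun p => ?_, fun p => ?_⟩
  · obtain ⟨U, e₁, e₂, a₁, a₂, b₁, b₂, hp, h⟩ := hex p₀
    have sα₁ := h.smooth_connForm c₁ h.smooth_a₁ h.smooth_a₂ h.field₁
    have sα₂ := h.smooth_connForm c₁ h.smooth_a₁ h.smooth_a₂ h.field₂
    have sβ₁ := h.smooth_connForm c₂ h.smooth_b₁ h.smooth_b₂ h.field₁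
    have sβ₂ := h.smooth_connForm c₂ h.smooth_b₁ h.smooth_b₂ h.field₂
    refine ⟨U, h.isOpen, hp, e₁, e₂, _, _,
      ProductSurface.IsAdaptedFrameOn.mu₁ c₁ c₂ θ₁ θ₂ e₂ a₁ a₂ b₁ b₂,
      ProductSurface.IsAdaptedFrameOn.mu₂ c₁ c₂ θ₁ θ₂ e₁ a₁ a₂ b₁ b₂, h.field₁, h.field₂,
      h.isNormalField₁, h.isNormalField₂,
      (contMDiffOn_const.mul sβ₂).sub (contMDiffOn_const.mul sα₂),
      (contMDiffOn_const.mul sα₁).sub (contMDiffOn_const.mul sβ₁), fun q hq => ?_⟩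
    obtain ⟨k₁, k₂, k₃, k₄⟩ := h.shape_adaptedNormal hψ hq
    exact ⟨h.isOrthonormalAt hq, h.fTensor_e₁ hq, h.fTensor_e₂ hq, h.tTensor_adaptedNormal₁ hψ hq,
      h.tTensor_adaptedNormal₂ hψ hq, k₁, k₂, k₃, k₄, fun v =>
        ⟨h.indMetric_leviCivita hψ hden hq v, h.prodMetric_normalConn hψ hden hq v⟩⟩
  · obtain ⟨U, e₁, e₂, a₁, a₂, b₁, b₂, hp, h⟩ := hex p
    exact h.isGaussCurvatureAt hψ hp
  · obtain ⟨U, e₁, e₂, a₁, a₂, b₁, b₂, hp, h⟩ := hex p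
    exact h.isNormalCurvatureAt hψ hC₁ hC₂ hS₁ hS₂ hp
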